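/- Theorem 2.13. Let $\mathsf C$ be a symmetric monoidal category with tensor product $\otimes$, unit object $K$ and symmetry $c$ (associativity and unit isomorphisms are suppressed, and an object also denotes its identity morphism). Algebras, coalgebras and Hopf algebras $(X,\eta,\mu,\varepsilon,\delta,\lambda)$ (unit, product, counit, coproduct, antipode) are taken in $\mathsf C$. Definitions. A *Hopf brace* $(X_1,X_2)$ on an object $X$ is a pair of Hopf algebras $X_i=(X,\eta^i_X,\mu^i_X,\varepsilon_X,\delta_X,\lambda^i_X)$, $i=1,2$, with the same underlying coalgebra, such that $$\mu_X^2\circ(X\otimes\mu_X^1)=\mu_X^1\circ(\mu_X^2\otimes\Gamma_{X_1})\circ(X\otimes c_{X,X}\otimes X)\circ(\delta_X\otimes X\otimes X),$$ where $\Gamma_{X_1}=\mu_X^1\circ(\lambda_X^1\otimes\mu_X^2)\circ(\delta_X\otimes X)$. Put also $\Gamma'_{X_1}=\mu_X^1\circ(\mu_X^2\otimes\lambda_X^1)\circ(X\otimes c_{X,X})\circ(\delta_X\otimes X)$. A *matched pair* $(A,H,\varphi,\phi)$ of Hopf algebras consists of Hopf algebras $A,H$ and morphisms $\varphi:H\otimes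 A\to A$, $\phi:H\otimes A\to H$ such that $(A,\varphi)$ is a left $H$-module coalgebra, $(H,\phi)$ is a right $A$-module coalgebra and, with $\Psi=(\varphi\otimes\phi)\circ(H\otimes c_{H,A}\otimes A)\circ(\delta_H\otimes\delta_A)$, $$\varphi\circ(H\otimes\eta_A)=\varepsilon_H\otimes\eta_A,\qquad \phi\circ(\eta_H\otimes A)=\eta_H\otimes\varepsilon_A,$$ $$\varphi\circ(H\otimes\mu_A)=\mu_A\circ(A\otimes\varphi)\circ(\Psi\otimes A),\qquad \phi\circ(\mu_H\otimes A)=\mu_H\circ(\phi\otimes H)\circ(H\otimes\Psi),$$ $$c_{A,H}\circ\Psi=(\phi\otimes\varphi)\circ(H\otimes c_{H,A}\otimes A)\circ(\delta_H\otimes\delta_A).$$ Its *bicrossed product* $A\bowtie H$ is $A\otimes H$ with the tensor product unit, counit and coproduct, the product $(\mu_A\otimes\mu_H)\circ(A\otimes\Psi\otimes H)$ and the antipode $\Psi\circ(\lambda_H\otimes\lambda_A)\circ c_{A,H}$. If $(A,\varphi)$ is both a left $H$-module algebra and a left $H$-module coalgebra, it is *in the cocommutativity class of $H$* when $$(H\otimes\varphi)\circ((c_{H,H}\circ\delta_H)\otimes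 A)=(H\otimes\varphi)\circ(\delta_H\otimes A),$$ and then the *smash product* $A\sharp H$ is given by the same formulas as $A\bowtie H$, with $\Psi$ replaced by $(\varphi\otimes H)\circ(H\otimes c_{H,A})\circ(\delta_H\otimes A)$. Statement. Let $\mathbb A=(A_1,A_2)$ and $\mathbb H=(H_1,H_2)$ be Hopf braces in $\mathsf C$, on objects $A$ and $H$, such that (i) $(A_1,H_1,\varphi_A^1,\phi_H)$ is a matched pair of Hopf algebras; (ii) $(A_2,\varphi_A^2)$ is a left $H_2$-module algebra and a left $H_2$-module coalgebra, and it is in the cocommutativity class of $H_2$. Put $\Psi^1=(\varphi_A^1\otimes\phi_H)\circ(H\otimes c_{H,A}\otimes A)\circ(\delta_H\otimes\delta_A)$ and $\Psi^2=(\varphi_A^2\otimes H)\circ(H\otimes c_{H,A})\circ(\delta_H\otimes A)$. Then $(A_1\bowtie H_1,A_2\sharp H_2)$ is a Hopf brace in $\mathsf C$ if and only if the following three conditions hold: (C1) $(A\otimes\mu_H^1)\circ(\Psi^1\otimes\mu_H^2)\circ(H\otimes\Psi^2\otimes H)\circ(((\Gamma'_{H_1}\otimes H)\circ(H\otimes c_{H,H})\circ(\delta_H\otimes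 H))\otimes A\otimes H)=(A\otimes\mu_H^2)\circ(\Psi^2\otimes\mu_H^1)\circ(H\otimes\Psi^1\otimes H)$; (C2) $(\Gamma_{A_1}\otimes H)\circ(A\otimes\Psi^1)=\Psi^1\circ(H\otimes\Gamma_{A_1})\circ(c_{A,H}\otimes A)$; (C3) $\Psi^2\circ(H\otimes\mu_A^1)=(\mu_A^1\otimes H)\circ(A\otimes\Psi^2)\circ(\Psi^2\otimes A)$. -/

import Mathlib

open CategoryTheory MonoidalCategory BraidedCategory

namespace HopfBraces

universe v u

/-- The data `(η, μ, ε, δ, λ)` of a Hopf algebra on an object `X`, without any axioms. -/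
structure HopfData {C : Type u} [Category.{v} C] [MonoidalCategory C] (X : C) where
  /-- the unit `η` -/
  one : 𝟙_ C ⟶ X
  /-- the product `μ` -/
  mul : X ⊗ X ⟶ X
  /-- the counit `ε` -/
  counit : X ⟶ 𝟙_ C
  /-- the coproduct `δ` -/
  comul : X ⟶ X ⊗ X
  /-- the antipode `λ` -/
  antipode : X ⟶ X

section

variable {C : Type u} [Category.{v} C] [MonoidalCategory C]

/-- The tuple of morphisms is a Hopf algebra: an algebra and a coalgebra, such that the unit and the
product are coalgebra morphisms, and the antipode is the convolution inverse of the identity. -/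
structure HopfData.IsHopf [BraidedCategory C] {X : C} (h : HopfData X) : Prop where
  one_mul : h.one ▷ X ≫ h.mul = (λ_ X).hom
  mul_one : X ◁ h.one ≫ h.mul = (ρ_ X).hom
  mul_assoc : h.mul ▷ X ≫ h.mul = (α_ X X X).hom ≫ X ◁ h.mul ≫ h.mul
  counit_comul : h.comul ≫ h.counit ▷ X = (λ_ X).inv
  comul_counit : h.comul ≫ X ◁ h.counit = (ρ_ X).inv
  comul_assoc : h.comul ≫ X ◁ h.comul = h.comul ≫ h.comul ▷ X ≫ (α_ X X X).hom
  one_counit : h.one ≫ h.counit = 𝟙 (𝟙_ C)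
  one_comul : h.one ≫ h.comul = (λ_ (𝟙_ C)).inv ≫ (h.one ⊗ₘ h.one)
  mul_counit : h.mul ≫ h.counit = (h.counit ⊗ₘ h.counit) ≫ (λ_ (𝟙_ C)).hom
  mul_comul : h.mul ≫ h.comul =
    (h.comul ⊗ₘ h.comul) ≫ tensorμ X X X X ≫ (h.mul ⊗ₘ h.mul)
  antipode_left : h.comul ≫ h.antipode ▷ X ≫ h.mul = h.counit ≫ h.one
  antipode_right : h.comul ≫ X ◁ h.antipode ≫ h.mul = h.counit ≫ h.one

/-- The data underlying a Hopf monoid of Mathlib. -/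
def HopfData.ofHopfObj [BraidedCategory C] (X : C) (i : HopfObj X) : HopfData X where
  one := i.one
  mul := i.mul
  counit := i.counit
  comul := i.comul
  antipode := i.antipode

/-- `IsHopf` is Mathlib's notion of a Hopf monoid, stated for given structure morphisms. -/
theorem HopfData.isHopf_iff [BraidedCategory C] {X : C} (h : HopfData X) :
    h.IsHopf ↔ ∃ i : HopfObj X, h = HopfData.ofHopfObj X i := by
  constructor
  · intro H
    let i : HopfObj X :=
      { one := h.one
        mul := h.mul
        counit := h.counit
        comul := h.comul
        antipode := h.antipode
        one_mul := H.one_mul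
        mul_one := H.mul_one
        mul_assoc := H.mul_assoc
        counit_comul := H.counit_comul
        comul_counit := H.comul_counit
        comul_assoc := H.comul_assoc
        one_counit := H.one_counit
        one_comul := H.one_comul
        mul_counit := H.mul_counit
        mul_comul := H.mul_comul
        antipode_left := H.antipode_left
        antipode_right := H.antipode_right }
    exact ⟨i, rfl⟩
  · rintro ⟨i, rfl⟩
    exact
      { one_mul := i.one_mul
        mul_one := i.mul_one
        mul_assoc := i.mul_assoc
        counit_comul := i.counit_comul
        comul_counit := i.comul_counit
        comul_assoc := i.comul_assoc
        one_counit := i.one_counit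
        one_comul := i.one_comul
        mul_counit := i.mul_counit
        mul_comul := i.mul_comul
        antipode_left := i.antipode_left
        antipode_right := i.antipode_right }

/-- `Γ(x ⊗ y) = λ¹(x₁) ·₁ (x₂ ·₂ y)`. -/
def Gamma {X : C} (h₁ h₂ : HopfData X) : X ⊗ X ⟶ X :=
  h₁.comul ▷ X ≫ (α_ X X X).hom ≫ (h₁.antipode ⊗ₘ h₂.mul) ≫ h₁.mul

/-- `Γ'(x ⊗ y) = (x₁ ·₂ y) ·₁ λ¹(x₂)`. -/
def Gamma' [BraidedCategory C] {X : C} (h₁ h₂ : HopfData X) : X ⊗ X ⟶ X :=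
  h₁.comul ▷ X ≫ (α_ X X X).hom ≫ X ◁ (β_ X X).hom ≫ (α_ X X X).inv ≫
    (h₂.mul ⊗ₘ h₁.antipode) ≫ h₁.mul

/-- `(X₁, X₂)` is a Hopf brace: two Hopf algebras on the same object with the same coalgebra
structure, such that `x ·₂ (y ·₁ z) = (x₁ ·₂ y) ·₁ Γ(x₂ ⊗ z)`. -/
structure IsHopfBrace [BraidedCategory C] {X : C} (h₁ h₂ : HopfData X) : Prop where
  isHopf₁ : h₁.IsHopf
  isHopf₂ : h₂.IsHopf
  counit_eq : h₁.counit = h₂.counit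
  comul_eq : h₁.comul = h₂.comul
  compat : X ◁ h₁.mul ≫ h₂.mul =
    h₁.comul ▷ (X ⊗ X) ≫ tensorμ X X X X ≫ (h₂.mul ⊗ₘ Gamma h₁ h₂) ≫ h₁.mul

/-- `φ : H ⊗ M ⟶ M` is a left `H`-module structure on `M`. -/
structure IsLeftModule {H M : C} (h : HopfData H) (φ : H ⊗ M ⟶ M) : Prop where
  one_act : h.one ▷ M ≫ φ = (λ_ M).hom
  mul_act : h.mul ▷ M ≫ φ = (α_ H H M).hom ≫ H ◁ φ ≫ φ

/-- `ϕ : M ⊗ A ⟶ M` is a right `A`-module structure on `M`. -/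
structure IsRightModule {A M : C} (a : HopfData A) (ϕ : M ⊗ A ⟶ M) : Prop where
  act_one : M ◁ a.one ≫ ϕ = (ρ_ M).hom
  act_mul : M ◁ a.mul ≫ ϕ = (α_ M A A).inv ≫ ϕ ▷ A ≫ ϕ

/-- The diagonal left action of `H` on `M ⊗ M`. -/
def diagLeft [BraidedCategory C] {H M : C} (h : HopfData H) (φ : H ⊗ M ⟶ M) :
    H ⊗ (M ⊗ M) ⟶ M ⊗ M :=
  h.comul ▷ (M ⊗ M) ≫ tensorμ H H M M ≫ (φ ⊗ₘ φ)

/-- The diagonal right action of `A` on `M ⊗ M`. -/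
def diagRight [BraidedCategory C] {A M : C} (a : HopfData A) (ϕ : M ⊗ A ⟶ M) :
    (M ⊗ M) ⊗ A ⟶ M ⊗ M :=
  (M ⊗ M) ◁ a.comul ≫ tensorμ M M A A ≫ (ϕ ⊗ₘ ϕ)

/-- `(A, φ)` is a left `H`-module algebra (only the algebra structure of `A` is involved). -/
structure IsLeftModuleAlgebra [BraidedCategory C] {H A : C} (h : HopfData H) (a : HopfData A)
    (φ : H ⊗ A ⟶ A) : Prop extends IsLeftModule h φ where
  act_one : H ◁ a.one ≫ φ = (ρ_ H).hom ≫ h.counit ≫ a.one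
  act_mul : H ◁ a.mul ≫ φ = diagLeft h φ ≫ a.mul

/-- `(A, φ)` is a left `H`-module coalgebra (only the coalgebra structure of `A` is involved). -/
structure IsLeftModuleCoalgebra [BraidedCategory C] {H A : C} (h : HopfData H) (a : HopfData A)
    (φ : H ⊗ A ⟶ A) : Prop extends IsLeftModule h φ where
  act_counit : φ ≫ a.counit = (h.counit ⊗ₘ a.counit) ≫ (λ_ (𝟙_ C)).hom
  act_comul : φ ≫ a.comul = H ◁ a.comul ≫ diagLeft h φ

/-- `(H, ϕ)` is a right `A`-module coalgebra (only the coalgebra structure of `H` is involved). -/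
structure IsRightModuleCoalgebra [BraidedCategory C] {A H : C} (a : HopfData A) (h : HopfData H)
    (ϕ : H ⊗ A ⟶ H) : Prop extends IsRightModule a ϕ where
  act_counit : ϕ ≫ h.counit = (h.counit ⊗ₘ a.counit) ≫ (λ_ (𝟙_ C)).hom
  act_comul : ϕ ≫ h.comul = h.comul ▷ A ≫ diagRight a ϕ

/-- `Ψ(x ⊗ y) = φ(x₁ ⊗ y₁) ⊗ ϕ(x₂ ⊗ y₂)`. -/
def Psi [BraidedCategory C] {A H : C} (a : HopfData A) (h : HopfData H)
    (φ : H ⊗ A ⟶ A) (ϕ : H ⊗ A ⟶ H) : H ⊗ A ⟶ A ⊗ H :=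
  (h.comul ⊗ₘ a.comul) ≫ tensorμ H H A A ≫ (φ ⊗ₘ ϕ)

/-- `Ψ(x ⊗ y) = φ(x₁ ⊗ y) ⊗ x₂`. -/
def smashPsi [BraidedCategory C] {A H : C} (h : HopfData H) (φ : H ⊗ A ⟶ A) : H ⊗ A ⟶ A ⊗ H :=
  h.comul ▷ A ≫ (α_ H H A).hom ≫ H ◁ (β_ H A).hom ≫ (α_ H A H).inv ≫ φ ▷ H

/-- `(A, H, φ, ϕ)` is a matched pair of Hopf algebras. -/
structure IsMatchedPair [BraidedCategory C] {A H : C} (a : HopfData A) (h : HopfData H)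
    (φ : H ⊗ A ⟶ A) (ϕ : H ⊗ A ⟶ H) : Prop where
  isHopf_left : a.IsHopf
  isHopf_right : h.IsHopf
  leftModuleCoalgebra : IsLeftModuleCoalgebra h a φ
  rightModuleCoalgebra : IsRightModuleCoalgebra a h ϕ
  left_one : H ◁ a.one ≫ φ = (ρ_ H).hom ≫ h.counit ≫ a.one
  right_one : h.one ▷ A ≫ ϕ = (λ_ A).hom ≫ a.counit ≫ h.one
  left_mul : H ◁ a.mul ≫ φ =
    (α_ H A A).inv ≫ Psi a h φ ϕ ▷ A ≫ (α_ A H A).hom ≫ A ◁ φ ≫ a.mul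
  right_mul : h.mul ▷ A ≫ ϕ =
    (α_ H H A).hom ≫ H ◁ Psi a h φ ϕ ≫ (α_ H A H).inv ≫ ϕ ▷ H ≫ h.mul
  twist : Psi a h φ ϕ ≫ (β_ A H).hom = (h.comul ⊗ₘ a.comul) ≫ tensorμ H H A A ≫ (ϕ ⊗ₘ φ)

/-- `(A, φ)` is in the cocommutativity class of `H`: `x₂ ⊗ φ(x₁ ⊗ y) = x₁ ⊗ φ(x₂ ⊗ y)`. -/
def InCocommutativityClass [BraidedCategory C] {A H : C} (h : HopfData H) (φ : H ⊗ A ⟶ A) : Prop :=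
  (h.comul ≫ (β_ H H).hom) ▷ A ≫ (α_ H H A).hom ≫ H ◁ φ =
    h.comul ▷ A ≫ (α_ H H A).hom ≫ H ◁ φ

/-- The rebracketing `(W ⊗ X) ⊗ (Y ⊗ Z) ≅ W ⊗ ((X ⊗ Y) ⊗ Z)`. -/
def mid (W X Y Z : C) : (W ⊗ X) ⊗ (Y ⊗ Z) ≅ W ⊗ ((X ⊗ Y) ⊗ Z) :=
  α_ W X (Y ⊗ Z) ≪≫ whiskerLeftIso W (α_ X Y Z).symm

/-- The tensor product unit, counit and coproduct on `A ⊗ H`, with the product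
`(μ_A ⊗ μ_H) ∘ (A ⊗ Ψ ⊗ H)` and the antipode `Ψ ∘ (λ_H ⊗ λ_A) ∘ c`. -/
def twistedProduct [BraidedCategory C] {A H : C} (a : HopfData A) (h : HopfData H)
    (Ψ : H ⊗ A ⟶ A ⊗ H) : HopfData (A ⊗ H) where
  one := (λ_ (𝟙_ C)).inv ≫ (a.one ⊗ₘ h.one)
  mul := (mid A H A H).hom ≫ A ◁ (Ψ ▷ H) ≫ (mid A A H H).inv ≫ (a.mul ⊗ₘ h.mul)
  counit := (a.counit ⊗ₘ h.counit) ≫ (λ_ (𝟙_ C)).hom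
  comul := (a.comul ⊗ₘ h.comul) ≫ tensorμ A A H H
  antipode := (β_ A H).hom ≫ (h.antipode ⊗ₘ a.antipode) ≫ Ψ

/-- The structure morphisms of the bicrossed product `A ⋈ H`. -/
def bicrossed [BraidedCategory C] {A H : C} (a : HopfData A) (h : HopfData H)
    (φ : H ⊗ A ⟶ A) (ϕ : H ⊗ A ⟶ H) : HopfData (A ⊗ H) :=
  twistedProduct a h (Psi a h φ ϕ)

/-- The structure morphisms of the smash product `A ♯ H`. -/
def smash [BraidedCategory C] {A H : C} (a : HopfData A) (h : HopfData H)
    (φ : H ⊗ A ⟶ A) : HopfData (A ⊗ H) :=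
  twistedProduct a h (smashPsi h φ)

/-- `(A ⊗ μ¹) ∘ (Ψ₁ ⊗ μ²) ∘ (H ⊗ Ψ₂ ⊗ H) ∘ (((Γ' ⊗ H) ∘ (H ⊗ c) ∘ (δ ⊗ H)) ⊗ A ⊗ H)
  = (A ⊗ μ²) ∘ (Ψ₂ ⊗ μ¹) ∘ (H ⊗ Ψ₁ ⊗ H)`, as morphisms `H ⊗ H ⊗ A ⊗ H ⟶ A ⊗ H`. -/
def CondC1 [BraidedCategory C] {A H : C} (h₁ h₂ : HopfData H) (Ψ₁ Ψ₂ : H ⊗ A ⟶ A ⊗ H) : Prop :=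
  (h₁.comul ▷ H ≫ (α_ H H H).hom ≫ H ◁ (β_ H H).hom ≫ (α_ H H H).inv ≫
      Gamma' h₁ h₂ ▷ H) ▷ (A ⊗ H) ≫
    (mid H H A H).hom ≫ H ◁ (Ψ₂ ▷ H) ≫ (mid H A H H).inv ≫
      (Ψ₁ ⊗ₘ h₂.mul) ≫ (α_ A H H).hom ≫ A ◁ h₁.mul =
  (mid H H A H).hom ≫ H ◁ (Ψ₁ ▷ H) ≫ (mid H A H H).inv ≫
    (Ψ₂ ⊗ₘ h₁.mul) ≫ (α_ A H H).hom ≫ A ◁ h₂.mul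

/-- `(Γ ⊗ H) ∘ (A ⊗ Ψ₁) = Ψ₁ ∘ (H ⊗ Γ) ∘ (c ⊗ A)`,
as morphisms `A ⊗ H ⊗ A ⟶ A ⊗ H`. -/
def CondC2 [BraidedCategory C] {A H : C} (a₁ a₂ : HopfData A) (Ψ₁ : H ⊗ A ⟶ A ⊗ H) : Prop :=
  A ◁ Ψ₁ ≫ (α_ A A H).inv ≫ Gamma a₁ a₂ ▷ H =
  (α_ A H A).inv ≫ (β_ A H).hom ▷ A ≫ (α_ H A A).hom ≫ H ◁ Gamma a₁ a₂ ≫ Ψ₁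

/-- `Ψ₂ ∘ (H ⊗ μ¹) = (μ¹ ⊗ H) ∘ (A ⊗ Ψ₂) ∘ (Ψ₂ ⊗ A)`,
as morphisms `H ⊗ A ⊗ A ⟶ A ⊗ H`. -/
def CondC3 {A H : C} (a₁ : HopfData A) (Ψ₂ : H ⊗ A ⟶ A ⊗ H) : Prop :=
  H ◁ a₁.mul ≫ Ψ₂ =
  (α_ H A A).inv ≫ Ψ₂ ▷ A ≫ (α_ A H A).hom ≫ A ◁ Ψ₂ ≫ (α_ A A H).inv ≫ a₁.mul ▷ H

end

end HopfBraces

open CategoryTheory MonoidalCategory BraidedCategory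

namespace HopfBraces

open ComonObj

universe v u

/-! ### Calculus of maps out of a comonoid. -/

section Comonoids

variable {C : Type u} [Category.{v} C] [MonoidalCategory C] [BraidedCategory C]

/-! Write `Γ(x, b) = λ¹(x₁) ·₁ (x₂ ·₂ b)`. Convolution by the antipode is invertible, so the brace
axiom is equivalent to saying that `Γ` measures the first product: `Γ(x, b ·₁ b') = Γ(x₁, b) ·₁
Γ(x₂, b')` (`compat_iff_measuresAlong`).

This identity can be tested on generators in both variables. If it holds for `b = j` and `b = k`, it
holds for `b = j ·₁ k` (`MeasuresAlong.mul`). If `Γ(x, -)` measures, then `Γ(x ·₂ y, -) = Γ(x, Γ(y,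
-))` (`lact_mul_comp`), and a composite of measuring maps measures (`measuresAlong_tensor`). On `A ⊗
H` the two units of each brace agree (`IsHopfBrace.one_eq`), so both products have the same
inclusions of `A` and `H`, and `(a ⊗ 1)(1 ⊗ h) = a ⊗ h` for both. Hence `A` and `H` generate, and
four cases remain for `(x, b)`:

`A, A`: here `Γ` is `Γ_A ⊗ H`, so the brace `A` gives the identity; `A, H`: since `Γ_A(a, 1) = ε(a)
1`, the identity is (C2); `H, A`: since `h ·₂ a = φ(h₁, a) ⊗ h₂`, the factor `Γ` is absorbed and the
identity is (C3); `H, H`: the antipode inside `Γ` moves to the left factor, turns it into `Γ'`, and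
the identity is (C1).

Both products on `A ⊗ H` are Hopf algebras without these conditions. `Ψ` is a distributive law and a
coalgebra map, which suffices (`IsDistributive.isHopf`), and the smash product is the bicrossed
product with trivial right action (`isMatchedPair_fstHom`). -/

instance isComonHom_tensorHom {X Y X' Y' : C} [ComonObj X] [ComonObj Y] [ComonObj X'] [ComonObj Y']
    (f : X ⟶ X') (g : Y ⟶ Y') [IsComonHom f] [IsComonHom g] : IsComonHom (f ⊗ₘ g) where
  hom_counit := by
    rw [Comon.tensorObj_counit, Comon.tensorObj_counit, tensorHom_comp_tensorHom_assoc]; simp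
  hom_comul := by
    rw [Comon.tensorObj_comul, Comon.tensorObj_comul, tensorHom_comp_tensorHom_assoc,
      Category.assoc, ← tensorμ_natural, tensorHom_comp_tensorHom_assoc]; simp

instance isComonHom_whiskerRight {X X' : C} (Y : C) [ComonObj X] [ComonObj Y] [ComonObj X']
    (f : X ⟶ X') [IsComonHom f] : IsComonHom (f ▷ Y) := by
  rw [← tensorHom_id]; infer_instance

instance isComonHom_whiskerLeft {X X' : C} (Y : C) [ComonObj X] [ComonObj Y] [ComonObj X']
    (f : X ⟶ X') [IsComonHom f] : IsComonHom (Y ◁ f) := by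
  rw [← id_tensorHom]; infer_instance

instance isComonHom_associator (X Y Z : C) [ComonObj X] [ComonObj Y] [ComonObj Z] :
    IsComonHom (α_ X Y Z).hom where
  hom_counit := by
    simp only [Comon.tensorObj_counit, MonoidalCategory.tensorHom_def]
    monoidal
  hom_comul := by
    simp only [Comon.tensorObj_comul, tensorμ, MonoidalCategory.tensorHom_def,
      braiding_tensor_left_hom, braiding_tensor_right_hom]
    calc
      _ = 𝟙 _ ⊗≫ Δ[X] ▷ Y ▷ Z ⊗≫ X ◁ X ◁ Δ[Y] ▷ Z ⊗≫ X ◁ X ◁ Y ◁ Y ◁ Δ[Z] ⊗≫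
            X ◁ ((X ⊗ Y) ◁ (β_ Y Z).hom ≫ (β_ X Y).hom ▷ (Z ⊗ Y)) ▷ Z ⊗≫
              X ◁ Y ◁ (β_ X Z).hom ▷ Y ▷ Z ⊗≫ 𝟙 _ := by monoidal
      _ = 𝟙 _ ⊗≫ Δ[X] ▷ Y ▷ Z ⊗≫ X ◁ X ◁ Δ[Y] ▷ Z ⊗≫ X ◁ ((X ⊗ Y) ◁ (Y ◁ Δ[Z]) ≫
            (β_ X Y).hom ▷ (Y ⊗ Z ⊗ Z)) ⊗≫ X ◁ Y ◁ X ◁ (β_ Y Z).hom ▷ Z ⊗≫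
              X ◁ Y ◁ (β_ X Z).hom ▷ Y ▷ Z ⊗≫ 𝟙 _ := by
        rw [whisker_exchange]; monoidal
      _ = 𝟙 _ ⊗≫ Δ[X] ▷ Y ▷ Z ⊗≫ X ◁ X ◁ Δ[Y] ▷ Z ⊗≫ X ◁ (β_ X Y).hom ▷ Y ▷ Z ⊗≫
            X ◁ Y ◁ X ◁ Y ◁ Δ[Z] ⊗≫ X ◁ Y ◁ X ◁ (β_ Y Z).hom ▷ Z ⊗≫
              X ◁ Y ◁ (β_ X Z).hom ▷ Y ▷ Z ⊗≫ 𝟙 _ := by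
        rw [whisker_exchange]; monoidal
      _ = _ := by monoidal

/-- The map `(x, y) ↦ F(x₁, y) ⊗ x₂`. -/
def hat {X Y V : C} [ComonObj X] (F : X ⊗ Y ⟶ V) : X ⊗ Y ⟶ V ⊗ X :=
  Δ[X] ▷ Y ≫ (α_ X X Y).hom ≫ X ◁ (β_ X Y).hom ≫ (α_ X Y X).inv ≫ F ▷ X

variable {X Y Z V W T : C} [ComonObj X]

lemma hat_comp (F : X ⊗ Y ⟶ V) (v : V ⟶ W) : hat (F ≫ v) = hat F ≫ v ▷ X := by
  simp [hat]

lemma whiskerLeft_hat (y : Y ⟶ Z) (F : X ⊗ Z ⟶ V) : X ◁ y ≫ hat F = hat (X ◁ y ≫ F) := by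
  simp only [hat]
  calc
    _ = 𝟙 _ ⊗≫ (X ◁ y ≫ Δ[X] ▷ Z) ⊗≫ X ◁ (β_ X Z).hom ⊗≫ F ▷ X ⊗≫ 𝟙 _ := by monoidal
    _ = 𝟙 _ ⊗≫ Δ[X] ▷ Y ⊗≫ X ◁ (X ◁ y ≫ (β_ X Z).hom) ⊗≫ F ▷ X ⊗≫ 𝟙 _ := by
      rw [whisker_exchange]; monoidal
    _ = _ := by rw [braiding_naturality_right]; monoidal

lemma whiskerRight_hat {X' : C} [ComonObj X'] (i : X' ⟶ X) [IsComonHom i] (F : X ⊗ Y ⟶ V) :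
    i ▷ Y ≫ hat F = hat (i ▷ Y ≫ F) ≫ V ◁ i := by
  simp only [hat]
  calc
    _ = 𝟙 _ ⊗≫ (i ≫ Δ[X]) ▷ Y ⊗≫ X ◁ (β_ X Y).hom ⊗≫ F ▷ X ⊗≫ 𝟙 _ := by monoidal
    _ = 𝟙 _ ⊗≫ Δ[X'] ▷ Y ⊗≫ i ▷ (X' ⊗ Y) ⊗≫ X ◁ (i ▷ Y ≫ (β_ X Y).hom) ⊗≫ F ▷ X ⊗≫ 𝟙 _ := by
      rw [IsComonHom.hom_comul, MonoidalCategory.tensorHom_def]; monoidal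
    _ = 𝟙 _ ⊗≫ Δ[X'] ▷ Y ⊗≫ (i ▷ (X' ⊗ Y) ≫ X ◁ (β_ X' Y).hom) ⊗≫
          ((X ⊗ Y) ◁ i ≫ F ▷ X) ⊗≫ 𝟙 _ := by
      rw [braiding_naturality_left]; monoidal
    _ = _ := by rw [whisker_exchange, ← whisker_exchange]; monoidal

/-- The map `(x, y, z) ↦ F(x₁, y) ⊗ G(x₂, z)`. -/
def pair (F : X ⊗ Y ⟶ V) (G : X ⊗ Z ⟶ W) : X ⊗ (Y ⊗ Z) ⟶ V ⊗ W :=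
  (α_ X Y Z).inv ≫ hat F ▷ Z ≫ (α_ V X Z).hom ≫ V ◁ G

lemma pair_eq (F : X ⊗ Y ⟶ V) (G : X ⊗ Z ⟶ W) :
    pair F G = Δ[X] ▷ (Y ⊗ Z) ≫ tensorμ X X Y Z ≫ (F ⊗ₘ G) := by
  simp only [pair, hat, tensorμ, MonoidalCategory.tensorHom_def]
  monoidal

lemma hat_hat (F : X ⊗ Y ⟶ V) :
    hat (hat F) = hat F ≫ V ◁ Δ[X] ≫ (α_ V X X).inv := by
  simp only [hat]
  calc
    _ = 𝟙 _ ⊗≫ Δ[X] ▷ Y ⊗≫ (X ◁ (β_ X Y).hom ≫ Δ[X] ▷ (Y ⊗ X)) ⊗≫ X ◁ (β_ X Y).hom ▷ X ⊗≫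
          F ▷ X ▷ X ⊗≫ 𝟙 _ := by monoidal
    _ = 𝟙 _ ⊗≫ (Δ[X] ≫ Δ[X] ▷ X ≫ (α_ X X X).hom) ▷ Y ⊗≫ (X ⊗ X) ◁ (β_ X Y).hom ⊗≫
          X ◁ (β_ X Y).hom ▷ X ⊗≫ F ▷ X ▷ X ⊗≫ 𝟙 _ := by
      rw [whisker_exchange]; monoidal
    _ = 𝟙 _ ⊗≫ Δ[X] ▷ Y ⊗≫ X ◁ (Δ[X] ▷ Y ≫ (β_ (X ⊗ X) Y).hom) ⊗≫ F ▷ (X ⊗ X) ⊗≫ 𝟙 _ := by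
      rw [← comul_assoc, braiding_tensor_left_hom]; monoidal
    _ = 𝟙 _ ⊗≫ Δ[X] ▷ Y ⊗≫ X ◁ (β_ X Y).hom ⊗≫ ((X ⊗ Y) ◁ Δ[X] ≫ F ▷ (X ⊗ X)) ⊗≫ 𝟙 _ := by
      rw [braiding_naturality_left]; monoidal
    _ = _ := by rw [whisker_exchange]; monoidal

lemma hat_pair (F : X ⊗ Y ⟶ V) (G : X ⊗ Z ⟶ W) :
    hat (pair F G) = (α_ X Y Z).inv ≫ hat F ▷ Z ≫ (α_ V X Z).hom ≫ V ◁ hat G ≫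
      (α_ V W X).inv := by
  simp only [pair]
  calc
    _ = 𝟙 _ ⊗≫ Δ[X] ▷ (Y ⊗ Z) ⊗≫ X ◁ (β_ X (Y ⊗ Z)).hom ⊗≫ hat F ▷ Z ▷ X ⊗≫ V ◁ G ▷ X ⊗≫ 𝟙 _ := by
      simp only [hat]; monoidal
    _ = 𝟙 _ ⊗≫ Δ[X] ▷ Y ▷ Z ⊗≫ X ◁ (β_ X Y).hom ▷ Z ⊗≫ ((X ⊗ Y) ◁ (β_ X Z).hom ≫
          hat F ▷ (Z ⊗ X)) ⊗≫ V ◁ G ▷ X ⊗≫ 𝟙 _ := by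
      rw [braiding_tensor_right_hom]; monoidal
    _ = 𝟙 _ ⊗≫ hat (hat F) ▷ Z ⊗≫ (V ⊗ X) ◁ (β_ X Z).hom ⊗≫ V ◁ G ▷ X ⊗≫ 𝟙 _ := by
      rw [whisker_exchange]; simp only [hat]; monoidal
    _ = _ := by rw [hat_hat]; simp only [hat]; monoidal

/-- The crossings of `X` with `Y` and with `Z` combine into one crossing with `Y ⊗ Z`, through which
`G` slides. This is what lets successive actions of `Y` and `X` be treated as one action of the
comonoid `X ⊗ Y`. -/
lemma hat_tensor [ComonObj Y] (F : X ⊗ V ⟶ W) (G : Y ⊗ Z ⟶ V) :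
    hat ((α_ X Y Z).hom ≫ X ◁ G ≫ F) = (α_ X Y Z).hom ≫ X ◁ hat G ≫ (α_ X V Y).inv ≫
      hat F ▷ Y ≫ (α_ W X Y).hom := by
  calc
    _ = 𝟙 _ ⊗≫ (Δ[X] ▷ Y ≫ (X ⊗ X) ◁ Δ[Y]) ▷ Z ⊗≫ X ◁ ((β_ X Y).hom ▷ (Y ⊗ Z) ≫
          (Y ⊗ X) ◁ (β_ Y Z).hom) ⊗≫ X ◁ Y ◁ (β_ X Z).hom ▷ Y ⊗≫ X ◁ G ▷ (X ⊗ Y) ⊗≫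
            F ▷ (X ⊗ Y) ⊗≫ 𝟙 _ := by
      simp only [hat, Comon.tensorObj_comul, tensorμ, MonoidalCategory.tensorHom_def,
        braiding_tensor_left_hom]
      monoidal
    _ = 𝟙 _ ⊗≫ X ◁ Δ[Y] ▷ Z ⊗≫ (Δ[X] ▷ (Y ⊗ (Y ⊗ Z)) ≫ (X ⊗ X) ◁ (Y ◁ (β_ Y Z).hom)) ⊗≫
          X ◁ (β_ X Y).hom ▷ Z ▷ Y ⊗≫ X ◁ Y ◁ (β_ X Z).hom ▷ Y ⊗≫ X ◁ G ▷ (X ⊗ Y) ⊗≫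
            F ▷ (X ⊗ Y) ⊗≫ 𝟙 _ := by
      rw [← whisker_exchange, ← whisker_exchange]; monoidal
    _ = 𝟙 _ ⊗≫ X ◁ Δ[Y] ▷ Z ⊗≫ X ◁ Y ◁ (β_ Y Z).hom ⊗≫ Δ[X] ▷ (Y ⊗ Z) ▷ Y ⊗≫
          X ◁ ((β_ X (Y ⊗ Z)).hom ≫ G ▷ X) ▷ Y ⊗≫
            F ▷ (X ⊗ Y) ⊗≫ 𝟙 _ := by
      rw [← whisker_exchange, braiding_tensor_right_hom]; monoidal
    _ = 𝟙 _ ⊗≫ X ◁ Δ[Y] ▷ Z ⊗≫ X ◁ Y ◁ (β_ Y Z).hom ⊗≫ (Δ[X] ▷ (Y ⊗ Z) ≫ (X ⊗ X) ◁ G) ▷ Y ⊗≫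
          X ◁ (β_ X V).hom ▷ Y ⊗≫ F ▷ (X ⊗ Y) ⊗≫ 𝟙 _ := by
      rw [← braiding_naturality_right]; monoidal
    _ = _ := by rw [← whisker_exchange]; simp only [hat]; monoidal

end Comonoids

/-! ### Convolution actions and measuring maps. -/

section Measuring

variable {C : Type u} [Category.{v} C] [MonoidalCategory C]
variable {X X' Y Z V W T Y' Z' V' W' B : C} [ComonObj X] [ComonObj X']

/-- `(x, t) ↦ u(x₁) F(x₂, t)`. -/
def lact (m : B ⊗ B ⟶ B) (u : X ⟶ B) (F : X ⊗ T ⟶ B) : X ⊗ T ⟶ B :=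
  Δ[X] ▷ T ≫ (α_ X X T).hom ≫ (u ⊗ₘ F) ≫ m

variable {m : B ⊗ B ⟶ B}

lemma whiskerLeft_lact (t : Y ⟶ T) (u : X ⟶ B) (F : X ⊗ T ⟶ B) :
    X ◁ t ≫ lact m u F = lact m u (X ◁ t ≫ F) := by
  simp only [lact, MonoidalCategory.tensorHom_def]
  calc
    _ = (X ◁ t ≫ Δ[X] ▷ T) ⊗≫ u ▷ (X ⊗ T) ⊗≫ B ◁ F ≫ m := by monoidal
    _ = 𝟙 _ ⊗≫ Δ[X] ▷ Y ⊗≫ (X ◁ (X ◁ t) ≫ u ▷ (X ⊗ T)) ⊗≫ B ◁ F ≫ m := by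
      rw [whisker_exchange]; monoidal
    _ = _ := by rw [whisker_exchange]; monoidal

lemma whiskerRight_lact (i : X' ⟶ X) [IsComonHom i] (u : X ⟶ B) (F : X ⊗ T ⟶ B) :
    i ▷ T ≫ lact m u F = lact m (i ≫ u) (i ▷ T ≫ F) := by
  simp only [lact, MonoidalCategory.tensorHom_def]
  calc
    _ = (i ≫ Δ[X]) ▷ T ⊗≫ u ▷ (X ⊗ T) ⊗≫ B ◁ F ≫ m := by monoidal
    _ = 𝟙 _ ⊗≫ Δ[X'] ▷ T ⊗≫ i ▷ (X' ⊗ T) ⊗≫ (X ◁ (i ▷ T) ≫ u ▷ (X ⊗ T)) ⊗≫ B ◁ F ≫ m := by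
      rw [IsComonHom.hom_comul, MonoidalCategory.tensorHom_def]; monoidal
    _ = _ := by rw [whisker_exchange]; monoidal

/-- With `lact_counit`, this makes `lact` an action of the convolution algebra of maps `X ⟶ B`, so
acting by a convolution-invertible map can be cancelled. -/
lemma lact_lact (hm : m ▷ B ≫ m = (α_ B B B).hom ≫ B ◁ m ≫ m) (u w : X ⟶ B) (F : X ⊗ T ⟶ B) :
    lact m u (lact m w F) = lact m (Δ[X] ≫ (u ⊗ₘ w) ≫ m) F := by
  simp only [lact, MonoidalCategory.tensorHom_def]
  calc
    _ = 𝟙 _ ⊗≫ Δ[X] ▷ T ⊗≫ (u ▷ (X ⊗ T) ≫ B ◁ (Δ[X] ▷ T)) ⊗≫ B ◁ w ▷ (X ⊗ T) ⊗≫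
          B ◁ B ◁ F ⊗≫ ((α_ B B B).hom ≫ B ◁ m ≫ m) := by monoidal
    _ = 𝟙 _ ⊗≫ (Δ[X] ≫ X ◁ Δ[X]) ▷ T ⊗≫ u ▷ (X ⊗ (X ⊗ T)) ⊗≫ B ◁ w ▷ (X ⊗ T) ⊗≫
          ((B ⊗ B) ◁ F ≫ m ▷ B) ⊗≫ m := by
      rw [← hm, ← whisker_exchange]; monoidal
    _ = _ := by rw [whisker_exchange, comul_assoc]; monoidal

lemma lact_counit {e : 𝟙_ C ⟶ B} (hm : e ▷ B ≫ m = (λ_ B).hom) (F : X ⊗ T ⟶ B) :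
    lact m (ε[X] ≫ e) F = F := by
  simp only [lact, MonoidalCategory.tensorHom_def]
  calc
    _ = 𝟙 _ ⊗≫ (Δ[X] ≫ ε[X] ▷ X) ▷ T ⊗≫ (e ▷ (X ⊗ T) ≫ B ◁ F) ≫ m := by monoidal
    _ = 𝟙 _ ⊗≫ F ⊗≫ (e ▷ B ≫ m) := by
      rw [counit_comul, ← whisker_exchange]; monoidal
    _ = _ := by rw [hm]; monoidal

variable [BraidedCategory C]

lemma pair_naturality (y : Y' ⟶ Y) (z : Z' ⟶ Z) (F : X ⊗ Y ⟶ V) (G : X ⊗ Z ⟶ W) :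
    X ◁ (y ⊗ₘ z) ≫ pair F G = pair (X ◁ y ≫ F) (X ◁ z ≫ G) := by
  simp only [pair]
  calc
    _ = 𝟙 _ ⊗≫ (X ◁ y ≫ hat F) ▷ Z' ⊗≫ V ◁ X ◁ z ⊗≫ V ◁ G := by
      rw [MonoidalCategory.tensorHom_def]
      calc
        _ = 𝟙 _ ⊗≫ X ◁ y ▷ Z' ⊗≫ ((X ⊗ Y) ◁ z ≫ hat F ▷ Z) ⊗≫ V ◁ G := by monoidal
        _ = _ := by rw [whisker_exchange]; monoidal
    _ = _ := by rw [whiskerLeft_hat]; monoidal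

lemma pair_comp (v : V ⟶ V') (w : W ⟶ W') (F : X ⊗ Y ⟶ V) (G : X ⊗ Z ⟶ W) :
    pair F G ≫ (v ⊗ₘ w) = pair (F ≫ v) (G ≫ w) := by
  simp only [pair]
  calc
    _ = 𝟙 _ ⊗≫ hat F ▷ Z ⊗≫ (V ◁ G ≫ v ▷ W) ⊗≫ V' ◁ w := by
      rw [MonoidalCategory.tensorHom_def]; monoidal
    _ = _ := by rw [whisker_exchange, hat_comp]; monoidal

lemma whiskerRight_pair (i : X' ⟶ X) [IsComonHom i] (F : X ⊗ Y ⟶ V) (G : X ⊗ Z ⟶ W) :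
    i ▷ (Y ⊗ Z) ≫ pair F G = pair (i ▷ Y ≫ F) (i ▷ Z ≫ G) := by
  simp only [pair]
  calc
    _ = 𝟙 _ ⊗≫ (i ▷ Y ≫ hat F) ▷ Z ⊗≫ V ◁ G := by monoidal
    _ = _ := by rw [whiskerRight_hat]; monoidal

lemma pair_assoc (F : X ⊗ Y ⟶ V) (G : X ⊗ Z ⟶ W) (K : X ⊗ Y' ⟶ V') :
    pair (pair F G) K = X ◁ (α_ Y Z Y').hom ≫ pair F (pair G K) ≫ (α_ V W V').inv := by
  rw [pair, hat_pair]
  simp only [pair]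
  monoidal

/-- `(x, t) ↦ F(x₁, t) u(x₂)`. -/
def ract (m : B ⊗ B ⟶ B) (F : X ⊗ T ⟶ B) (u : X ⟶ B) : X ⊗ T ⟶ B :=
  hat F ≫ B ◁ u ≫ m

lemma hat_lact (u : X ⟶ B) (F : X ⊗ T ⟶ B) :
    hat (lact m u F) = Δ[X] ▷ T ≫ (α_ X X T).hom ≫ (u ⊗ₘ hat F) ≫ (α_ B B X).inv ≫ m ▷ X := by
  simp only [lact, hat, MonoidalCategory.tensorHom_def]
  calc
    _ = 𝟙 _ ⊗≫ Δ[X] ▷ T ⊗≫ (X ◁ (β_ X T).hom ≫ Δ[X] ▷ (T ⊗ X)) ⊗≫ u ▷ (X ⊗ T ⊗ X) ⊗≫ B ◁ F ▷ X ⊗≫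
          m ▷ X := by monoidal
    _ = 𝟙 _ ⊗≫ (Δ[X] ≫ Δ[X] ▷ X ≫ (α_ X X X).hom) ▷ T ⊗≫ (X ◁ (X ◁ (β_ X T).hom) ≫
          u ▷ (X ⊗ T ⊗ X)) ⊗≫ B ◁ F ▷ X ⊗≫ m ▷ X := by
      rw [whisker_exchange]; monoidal
    _ = 𝟙 _ ⊗≫ Δ[X] ▷ T ⊗≫ (X ◁ (Δ[X] ▷ T) ≫ u ▷ ((X ⊗ X) ⊗ T)) ⊗≫ B ◁ X ◁ (β_ X T).hom ⊗≫
          B ◁ F ▷ X ⊗≫ m ▷ X := by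
      rw [whisker_exchange, ← comul_assoc]; monoidal
    _ = _ := by rw [whisker_exchange]; monoidal

lemma pair_lact_left (hm : m ▷ B ≫ m = (α_ B B B).hom ≫ B ◁ m ≫ m) (u : X ⟶ B)
    (F : X ⊗ Y ⟶ B) (G : X ⊗ Z ⟶ B) :
    pair (lact m u F) G ≫ m = lact m u (pair F G ≫ m) := by
  simp only [pair, lact]
  rw [← lact, hat_lact]
  simp only [MonoidalCategory.tensorHom_def]
  calc
    _ = 𝟙 _ ⊗≫ Δ[X] ▷ Y ▷ Z ⊗≫ u ▷ (X ⊗ Y ⊗ Z) ⊗≫ B ◁ hat F ▷ Z ⊗≫ (m ▷ (X ⊗ Z) ≫ B ◁ G) ⊗≫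
          m := by monoidal
    _ = 𝟙 _ ⊗≫ Δ[X] ▷ Y ▷ Z ⊗≫ u ▷ (X ⊗ Y ⊗ Z) ⊗≫ B ◁ hat F ▷ Z ⊗≫ B ◁ B ◁ G ⊗≫
          (m ▷ B ≫ m) := by rw [← whisker_exchange]; monoidal
    _ = _ := by rw [hm]; monoidal

lemma hat_ract (F : X ⊗ Y ⟶ B) (u : X ⟶ B) :
    hat (ract m F u) = hat F ≫ B ◁ Δ[X] ≫ (α_ B X X).inv ≫ (B ◁ u ≫ m) ▷ X := by
  rw [ract, hat_comp, hat_hat]; simp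

/-- Both sides are `F(x₁, y) u(x₂) G(x₃, z)`. This moves an antipode, or an inclusion, from one
factor to the other. -/
lemma pair_ract (hm : m ▷ B ≫ m = (α_ B B B).hom ≫ B ◁ m ≫ m) (F : X ⊗ Y ⟶ B) (u : X ⟶ B)
    (G : X ⊗ Z ⟶ B) : pair (ract m F u) G ≫ m = pair F (lact m u G) ≫ m := by
  simp only [pair, lact]
  rw [hat_ract]
  simp only [MonoidalCategory.tensorHom_def]
  calc
    _ = 𝟙 _ ⊗≫ hat F ▷ Z ⊗≫ B ◁ Δ[X] ▷ Z ⊗≫ B ◁ u ▷ (X ⊗ Z) ⊗≫ (m ▷ (X ⊗ Z) ≫ B ◁ G) ⊗≫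
          m := by monoidal
    _ = 𝟙 _ ⊗≫ hat F ▷ Z ⊗≫ B ◁ Δ[X] ▷ Z ⊗≫ B ◁ u ▷ (X ⊗ Z) ⊗≫ B ◁ B ◁ G ⊗≫
          (m ▷ B ≫ m) := by rw [← whisker_exchange]; monoidal
    _ = _ := by rw [hm]; monoidal

/-- `Γ(x, j(y) b) = Γ(x₁, j(y)) Γ(x₂, b)`. -/
def MeasuresAlong (m : B ⊗ B ⟶ B) (F : X ⊗ B ⟶ B) (j : Y ⟶ B) : Prop :=
  X ◁ (j ▷ B ≫ m) ≫ F = pair (X ◁ j ≫ F) F ≫ m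

/-- `F(x, j k b) = F(x₁, j) F(x₂, k b) = F(x₁, j) F(x₂, k) F(x₃, b)`, and the first two factors
recombine to `F(x₁, j k)` by coassociativity (`pair_assoc`). -/
lemma MeasuresAlong.mul (hm : m ▷ B ≫ m = (α_ B B B).hom ≫ B ◁ m ≫ m) {F : X ⊗ B ⟶ B}
    {j : Y ⟶ B} {k : Z ⟶ B} (hj : MeasuresAlong m F j) (hk : MeasuresAlong m F k) :
    MeasuresAlong m F ((j ⊗ₘ k) ≫ m) := by
  unfold MeasuresAlong at *
  -- The hypothesis on `j` with `b` specialised to `k`.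
  have h1 : X ◁ ((j ⊗ₘ k) ≫ m) ≫ F = pair (X ◁ j ≫ F) (X ◁ k ≫ F) ≫ m := by
    have := X ◁ (𝟙 Y ⊗ₘ k) ≫= hj
    rw [reassoc_of% pair_naturality] at this
    rw [← Category.id_comp (pair _ _), ← Category.assoc] at this
    simpa [MonoidalCategory.tensorHom_def', ← whisker_exchange_assoc] using this
  have h2 : X ◁ (((j ⊗ₘ k) ≫ m) ▷ B ≫ m) ≫ F =
      X ◁ (α_ Y Z B).hom ≫ X ◁ (Y ◁ (k ▷ B ≫ m)) ≫ X ◁ (j ▷ B ≫ m) ≫ F := by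
    simp only [← whiskerLeft_comp_assoc]
    congr 2
    rw [comp_whiskerRight_assoc, hm, MonoidalCategory.tensorHom_def']
    calc
      _ = (α_ Y Z B).hom ≫ Y ◁ (k ▷ B) ⊗≫ (j ▷ (B ⊗ B) ≫ B ◁ m) ≫ m := by monoidal
      _ = _ := by rw [← whisker_exchange]; monoidal
  rw [h2, hj, h1]
  have h3 := pair_naturality (𝟙 Y) (k ▷ B ≫ m) (X ◁ j ≫ F) F
  rw [id_tensorHom] at h3
  rw [reassoc_of% h3, hk]
  have h4 := pair_comp m (𝟙 B) (pair (X ◁ j ≫ F) (X ◁ k ≫ F)) F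
  rw [Category.comp_id] at h4
  have h5 := pair_comp (𝟙 B) m (X ◁ j ≫ F) (pair (X ◁ k ≫ F) F)
  rw [Category.comp_id] at h5
  rw [← h4, pair_assoc, whiskerLeft_id, Category.id_comp, ← h5, tensorHom_id, id_tensorHom]
  simp only [Category.assoc, hm, Iso.inv_hom_id_assoc]

lemma measuresAlong_tensor [ComonObj Y] {F : X ⊗ B ⟶ B} {G : Y ⊗ B ⟶ B}
    (hF : MeasuresAlong m F (𝟙 B)) (hG : MeasuresAlong m G (𝟙 B)) :
    MeasuresAlong m ((α_ X Y B).hom ≫ X ◁ G ≫ F) (𝟙 B) := by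
  unfold MeasuresAlong at *
  simp only [id_whiskerRight, Category.id_comp, whiskerLeft_id] at *
  have h1 : pair ((α_ X Y B).hom ≫ X ◁ G ≫ F) ((α_ X Y B).hom ≫ X ◁ G ≫ F) =
      (α_ X Y (B ⊗ B)).hom ≫ X ◁ pair G G ≫ pair F F := by
    simp only [pair]
    rw [hat_tensor]
    calc
      _ = 𝟙 _ ⊗≫ X ◁ hat G ▷ B ⊗≫ (hat F ▷ (Y ⊗ B) ≫ (B ⊗ X) ◁ G) ⊗≫ B ◁ F := by monoidal
      _ = _ := by rw [← whisker_exchange]; monoidal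
  rw [h1]
  simp only [Category.assoc, ← hF, ← whiskerLeft_comp_assoc, ← hG]
  simp

/-- Both sides of the measuring identity have the form `s(x₁) · (-)`, and `s` can be cancelled
because `i` is a convolution inverse on the left of it. With `s` an antipode this trades the
measuring identity for the shape of the brace axiom. -/
lemma measuresAlong_lact_iff (hm : m ▷ B ≫ m = (α_ B B B).hom ≫ B ◁ m ≫ m)
    {e : 𝟙_ C ⟶ B} (he : e ▷ B ≫ m = (λ_ B).hom) {i s : X ⟶ B}
    (h₁ : Δ[X] ≫ (i ⊗ₘ s) ≫ m = ε[X] ≫ e)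
    (L : X ⊗ B ⟶ B) (j : Y ⟶ B) :
    MeasuresAlong m (lact m s L) j ↔
      X ◁ (j ▷ B ≫ m) ≫ L = pair (X ◁ j ≫ L) (lact m s L) ≫ m := by
  have inj : ∀ {T : C} {F G : X ⊗ T ⟶ B}, lact m s F = lact m s G ↔ F = G := fun {T F G} =>
    ⟨fun h => by
      have := congrArg (lact m i) h
      rwa [lact_lact hm, lact_lact hm, h₁, lact_counit he, lact_counit he] at this,
     fun h => by rw [h]⟩
  rw [MeasuresAlong, whiskerLeft_lact, whiskerLeft_lact, pair_lact_left hm, inj]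

end Measuring

/-! ### Distributive laws and twisted products. -/

section Distributive

variable {C : Type u} [Category.{v} C] [MonoidalCategory C]

/-- `Ψ` is a distributive law between the algebras underlying `a` and `h`. -/
structure IsDistributive {A H : C} (a : HopfData A) (h : HopfData H) (Ψ : H ⊗ A ⟶ A ⊗ H) :
    Prop where
  one_left : h.one ▷ A ≫ Ψ = (λ_ A).hom ≫ (ρ_ A).inv ≫ A ◁ h.one
  one_right : H ◁ a.one ≫ Ψ = (ρ_ H).hom ≫ (λ_ H).inv ≫ a.one ▷ H
  mul_left : h.mul ▷ A ≫ Ψ =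
    (α_ H H A).hom ≫ H ◁ Ψ ≫ (α_ H A H).inv ≫ Ψ ▷ H ≫ (α_ A H H).hom ≫ A ◁ h.mul
  mul_right : H ◁ a.mul ≫ Ψ =
    (α_ H A A).inv ≫ Ψ ▷ A ≫ (α_ A H A).hom ≫ A ◁ Ψ ≫ (α_ A A H).inv ≫ a.mul ▷ H

/-- The inclusion of the first factor of a twisted product. -/
def inl (A : C) {H : C} (h : HopfData H) : A ⟶ A ⊗ H := (ρ_ A).inv ≫ A ◁ h.one

/-- The inclusion of the second factor of a twisted product. -/
def inr {A : C} (H : C) (a : HopfData A) : H ⟶ A ⊗ H := (λ_ H).inv ≫ a.one ▷ H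

variable [BraidedCategory C] {A H : C} {a : HopfData A} {h : HopfData H} {Ψ : H ⊗ A ⟶ A ⊗ H}

lemma twistedProduct_mul : (twistedProduct a h Ψ).mul =
    (α_ A H (A ⊗ H)).hom ≫ A ◁ (α_ H A H).inv ≫ A ◁ (Ψ ▷ H) ≫ A ◁ (α_ A H H).hom ≫
      (α_ A A (H ⊗ H)).inv ≫ a.mul ▷ (H ⊗ H) ≫ A ◁ h.mul := by
  simp [twistedProduct, mid, MonoidalCategory.tensorHom_def]

lemma one_inl : a.one ≫ inl A h = (twistedProduct a h Ψ).one := by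
  simp [twistedProduct, inl, MonoidalCategory.tensorHom_def, unitors_inv_equal]

lemma one_inr : h.one ≫ inr H a = (twistedProduct a h Ψ).one := by
  simp only [twistedProduct, inr, MonoidalCategory.tensorHom_def']
  monoidal

namespace IsDistributive

lemma inl_mul (hΨ : IsDistributive a h Ψ) (oneH : h.one ▷ H ≫ h.mul = (λ_ H).hom) :
    inl A h ▷ (A ⊗ H) ≫ (twistedProduct a h Ψ).mul = (α_ A A H).inv ≫ a.mul ▷ H := by
  rw [twistedProduct_mul, inl]
  calc
    _ = 𝟙 _ ⊗≫ A ◁ (h.one ▷ A ≫ Ψ) ▷ H ⊗≫ a.mul ▷ (H ⊗ H) ≫ A ◁ h.mul := by monoidal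
    _ = 𝟙 _ ⊗≫ ((A ⊗ A) ◁ (h.one ▷ H) ≫ a.mul ▷ (H ⊗ H)) ≫ A ◁ h.mul := by
      rw [hΨ.one_left]; monoidal
    _ = 𝟙 _ ⊗≫ a.mul ▷ (𝟙_ C ⊗ H) ⊗≫ A ◁ (h.one ▷ H ≫ h.mul) := by
      rw [whisker_exchange]; monoidal
    _ = _ := by rw [oneH]; monoidal

lemma mul_inr (hΨ : IsDistributive a h Ψ) (oneA : A ◁ a.one ≫ a.mul = (ρ_ A).hom) :
    (A ⊗ H) ◁ inr H a ≫ (twistedProduct a h Ψ).mul = (α_ A H H).hom ≫ A ◁ h.mul := by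
  rw [twistedProduct_mul, inr]
  calc
    _ = 𝟙 _ ⊗≫ A ◁ (H ◁ a.one ≫ Ψ) ▷ H ⊗≫ a.mul ▷ (H ⊗ H) ≫ A ◁ h.mul := by monoidal
    _ = 𝟙 _ ⊗≫ (A ◁ a.one ≫ a.mul) ▷ (H ⊗ H) ≫ A ◁ h.mul := by
      rw [hΨ.one_right]; monoidal
    _ = _ := by rw [oneA]; monoidal

lemma inl_mul_inl (hΨ : IsDistributive a h Ψ) (oneH : h.one ▷ H ≫ h.mul = (λ_ H).hom) :
    (inl A h ⊗ₘ inl A h) ≫ (twistedProduct a h Ψ).mul = a.mul ≫ inl A h := by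
  rw [MonoidalCategory.tensorHom_def', Category.assoc, hΨ.inl_mul oneH, inl]
  calc
    _ = 𝟙 _ ⊗≫ ((A ⊗ A) ◁ h.one ≫ a.mul ▷ H) := by monoidal
    _ = _ := by rw [whisker_exchange]; monoidal

lemma inr_mul_inr (hΨ : IsDistributive a h Ψ) (oneA : A ◁ a.one ≫ a.mul = (ρ_ A).hom) :
    (inr H a ⊗ₘ inr H a) ≫ (twistedProduct a h Ψ).mul = h.mul ≫ inr H a := by
  rw [MonoidalCategory.tensorHom_def, Category.assoc, hΨ.mul_inr oneA, inr]
  calc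
    _ = 𝟙 _ ⊗≫ (a.one ▷ (H ⊗ H) ≫ A ◁ h.mul) := by monoidal
    _ = _ := by rw [← whisker_exchange]; monoidal

lemma inl_mul_inr (hΨ : IsDistributive a h Ψ) (oneH : h.one ▷ H ≫ h.mul = (λ_ H).hom)
    (oneA : A ◁ a.one ≫ a.mul = (ρ_ A).hom) :
    (inl A h ⊗ₘ inr H a) ≫ (twistedProduct a h Ψ).mul = 𝟙 _ := by
  rw [MonoidalCategory.tensorHom_def', Category.assoc, hΨ.inl_mul oneH, inr]
  calc
    _ = 𝟙 _ ⊗≫ (A ◁ a.one ≫ a.mul) ▷ H := by monoidal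
    _ = _ := by rw [oneA]; monoidal

end IsDistributive

lemma inr_mul (oneA : a.one ▷ A ≫ a.mul = (λ_ A).hom) :
    inr H a ▷ (A ⊗ H) ≫ (twistedProduct a h Ψ).mul =
      (α_ H A H).inv ≫ Ψ ▷ H ≫ (α_ A H H).hom ≫ A ◁ h.mul := by
  rw [twistedProduct_mul, inr]
  calc
    _ = 𝟙 _ ⊗≫ (a.one ▷ (H ⊗ A ⊗ H) ≫ A ◁ ((α_ H A H).inv ≫ Ψ ▷ H)) ⊗≫
          a.mul ▷ (H ⊗ H) ≫ A ◁ h.mul := by monoidal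
    _ = 𝟙 _ ⊗≫ Ψ ▷ H ⊗≫ (a.one ▷ A ≫ a.mul) ▷ (H ⊗ H) ≫ A ◁ h.mul := by
      rw [← whisker_exchange]; monoidal
    _ = _ := by rw [oneA]; monoidal

lemma inr_mul_inl (oneA : a.one ▷ A ≫ a.mul = (λ_ A).hom)
    (oneH : H ◁ h.one ≫ h.mul = (ρ_ H).hom) :
    (inr H a ⊗ₘ inl A h) ≫ (twistedProduct a h Ψ).mul = Ψ := by
  rw [MonoidalCategory.tensorHom_def', Category.assoc, inr_mul oneA, inl]
  calc
    _ = 𝟙 _ ⊗≫ ((H ⊗ A) ◁ h.one ≫ Ψ ▷ H) ⊗≫ A ◁ h.mul := by monoidal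
    _ = 𝟙 _ ⊗≫ Ψ ⊗≫ A ◁ (H ◁ h.one ≫ h.mul) := by rw [whisker_exchange]; monoidal
    _ = _ := by rw [oneH]; monoidal

namespace IsDistributive

/-- Both bracketings reduce to applying `Ψ` to every pair that is out of order and then multiplying;
`mul_left` and `mul_right` carry `Ψ` past the inner products. -/
lemma mul_assoc (hΨ : IsDistributive a h Ψ)
    (assocA : a.mul ▷ A ≫ a.mul = (α_ A A A).hom ≫ A ◁ a.mul ≫ a.mul)
    (assocH : h.mul ▷ H ≫ h.mul = (α_ H H H).hom ≫ H ◁ h.mul ≫ h.mul) :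
    (twistedProduct a h Ψ).mul ▷ (A ⊗ H) ≫ (twistedProduct a h Ψ).mul =
      (α_ _ _ _).hom ≫ (A ⊗ H) ◁ (twistedProduct a h Ψ).mul ≫ (twistedProduct a h Ψ).mul := by
  rw [twistedProduct_mul]
  calc
    _ = 𝟙 _ ⊗≫ A ◁ Ψ ▷ (H ⊗ A ⊗ H) ⊗≫ (a.mul ▷ (((H ⊗ H) ⊗ A) ⊗ H) ≫
          A ◁ ((h.mul ▷ A ≫ Ψ) ▷ H)) ⊗≫ a.mul ▷ (H ⊗ H) ⊗≫ A ◁ h.mul := by monoidal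
    _ = 𝟙 _ ⊗≫ A ◁ Ψ ▷ (H ⊗ A ⊗ H) ⊗≫ (A ⊗ A) ◁ ((h.mul ▷ A ≫ Ψ) ▷ H) ⊗≫
          (a.mul ▷ A ≫ a.mul) ▷ (H ⊗ H) ⊗≫ A ◁ h.mul := by
      rw [← whisker_exchange]; monoidal
    _ = 𝟙 _ ⊗≫ A ◁ Ψ ▷ (H ⊗ A ⊗ H) ⊗≫ A ◁ A ◁ H ◁ Ψ ▷ H ⊗≫ A ◁ A ◁ Ψ ▷ H ▷ H ⊗≫
          ((A ⊗ A ⊗ A) ◁ (h.mul ▷ H) ≫ (A ◁ a.mul ≫ a.mul) ▷ (H ⊗ H)) ⊗≫ A ◁ h.mul := by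
      rw [hΨ.mul_left, assocA]; monoidal
    _ = 𝟙 _ ⊗≫ A ◁ Ψ ▷ (H ⊗ A ⊗ H) ⊗≫ A ◁ A ◁ H ◁ Ψ ▷ H ⊗≫ A ◁ A ◁ Ψ ▷ H ▷ H ⊗≫
          (A ◁ a.mul ≫ a.mul) ▷ (H ⊗ H ⊗ H) ⊗≫ A ◁ (h.mul ▷ H ≫ h.mul) := by
      rw [whisker_exchange]; monoidal
    _ = 𝟙 _ ⊗≫ A ◁ ((H ⊗ A) ◁ Ψ ≫ Ψ ▷ (A ⊗ H)) ▷ H ⊗≫ A ◁ A ◁ Ψ ▷ H ▷ H ⊗≫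
          A ◁ a.mul ▷ (H ⊗ H ⊗ H) ⊗≫ (a.mul ▷ (H ⊗ H ⊗ H) ≫ A ◁ (H ◁ h.mul)) ⊗≫
            A ◁ h.mul := by
      rw [assocH, whisker_exchange]; monoidal
    _ = 𝟙 _ ⊗≫ A ◁ H ◁ A ◁ Ψ ▷ H ⊗≫ A ◁ (H ◁ a.mul ≫ Ψ) ▷ H ▷ H ⊗≫
          (A ⊗ A) ◁ (H ◁ h.mul) ⊗≫ a.mul ▷ (H ⊗ H) ⊗≫ A ◁ h.mul := by
      rw [← whisker_exchange, hΨ.mul_right]; monoidal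
    _ = 𝟙 _ ⊗≫ A ◁ H ◁ A ◁ Ψ ▷ H ⊗≫ A ◁ H ◁ a.mul ▷ (H ⊗ H) ⊗≫
          A ◁ (Ψ ▷ (H ⊗ H) ≫ (A ⊗ H) ◁ h.mul) ⊗≫ a.mul ▷ (H ⊗ H) ⊗≫ A ◁ h.mul := by
      monoidal
    _ = _ := by rw [← whisker_exchange]; monoidal

lemma one_mul (hΨ : IsDistributive a h Ψ) (oneA : a.one ▷ A ≫ a.mul = (λ_ A).hom)
    (oneH : h.one ▷ H ≫ h.mul = (λ_ H).hom) :
    (twistedProduct a h Ψ).one ▷ (A ⊗ H) ≫ (twistedProduct a h Ψ).mul = (λ_ (A ⊗ H)).hom := by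
  rw [← one_inl, comp_whiskerRight, Category.assoc, hΨ.inl_mul oneH]
  calc
    _ = 𝟙 _ ⊗≫ (a.one ▷ A ≫ a.mul) ▷ H := by monoidal
    _ = _ := by rw [oneA]; monoidal

lemma mul_one (hΨ : IsDistributive a h Ψ) (oneA : A ◁ a.one ≫ a.mul = (ρ_ A).hom)
    (oneH : H ◁ h.one ≫ h.mul = (ρ_ H).hom) :
    (A ⊗ H) ◁ (twistedProduct a h Ψ).one ≫ (twistedProduct a h Ψ).mul = (ρ_ (A ⊗ H)).hom := by
  rw [← one_inr, MonoidalCategory.whiskerLeft_comp, Category.assoc, hΨ.mul_inr oneA]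
  calc
    _ = 𝟙 _ ⊗≫ A ◁ (H ◁ h.one ≫ h.mul) := by monoidal
    _ = _ := by rw [oneH]; monoidal

end IsDistributive

end Distributive

/-! ### Convolution, and the distributive law of a matched pair. -/

section Bicrossed

variable {C : Type u} [Category.{v} C] [MonoidalCategory C]

section Convolution

variable {T B B' : C} [ComonObj T]

/-- The convolution product of morphisms from a comonoid to a monoid. -/
def conv (m : B ⊗ B ⟶ B) (f g : T ⟶ B) : T ⟶ B := Δ[T] ≫ (f ⊗ₘ g) ≫ m

lemma conv_assoc {m : B ⊗ B ⟶ B} (hm : m ▷ B ≫ m = (α_ B B B).hom ≫ B ◁ m ≫ m) (f g k : T ⟶ B) :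
    conv m (conv m f g) k = conv m f (conv m g k) := by
  simp only [conv, MonoidalCategory.tensorHom_def]
  calc
    _ = 𝟙 _ ⊗≫ (Δ[T] ≫ Δ[T] ▷ T) ⊗≫ f ▷ T ▷ T ⊗≫ B ◁ g ▷ T ⊗≫ (m ▷ T ≫ B ◁ k) ⊗≫ m := by monoidal
    _ = 𝟙 _ ⊗≫ Δ[T] ⊗≫ (T ◁ Δ[T] ≫ f ▷ (T ⊗ T)) ⊗≫ B ◁ g ▷ T ⊗≫ B ◁ B ◁ k ⊗≫ (m ▷ B ≫ m) := by
      rw [comul_assoc_flip, ← whisker_exchange]; monoidal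
    _ = _ := by rw [hm, whisker_exchange]; monoidal

lemma one_conv {m : B ⊗ B ⟶ B} {e : 𝟙_ C ⟶ B} (he : e ▷ B ≫ m = (λ_ B).hom) (f : T ⟶ B) :
    conv m (ε[T] ≫ e) f = f := by
  simp only [conv, MonoidalCategory.tensorHom_def]
  calc
    _ = 𝟙 _ ⊗≫ (Δ[T] ≫ ε[T] ▷ T) ⊗≫ (e ▷ T ≫ B ◁ f) ⊗≫ m := by monoidal
    _ = 𝟙 _ ⊗≫ f ⊗≫ (e ▷ B ≫ m) := by rw [counit_comul, ← whisker_exchange]; monoidal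
    _ = _ := by rw [he]; monoidal

lemma comp_conv {T' : C} [ComonObj T'] (t : T' ⟶ T) [IsComonHom t] (m : B ⊗ B ⟶ B) (f g : T ⟶ B) :
    t ≫ conv m f g = conv m (t ≫ f) (t ≫ g) := by
  rw [conv, IsComonHom.hom_comul_assoc, tensorHom_comp_tensorHom_assoc, conv]

lemma conv_comp {m : B ⊗ B ⟶ B} {m' : B' ⊗ B' ⟶ B'} {p : B ⟶ B'} (hp : (p ⊗ₘ p) ≫ m' = m ≫ p)
    (f g : T ⟶ B) : conv m f g ≫ p = conv m' (f ≫ p) (g ≫ p) := by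
  simp only [conv, Category.assoc, ← hp, tensorHom_comp_tensorHom_assoc]

end Convolution

variable [BraidedCategory C] {A H : C}

/-- After coassociativity the two sides differ only in the two middle copies of `T`, to which `comm`
applies. -/
lemma isComonHom_lift {T : C} [ComonObj A] [ComonObj H] [ComonObj T] (f : T ⟶ A) (g : T ⟶ H)
    [IsComonHom f] [IsComonHom g]
    (comm : Δ[T] ≫ (f ⊗ₘ g) ≫ (β_ A H).hom = Δ[T] ≫ (g ⊗ₘ f)) :
    IsComonHom (Δ[T] ≫ (f ⊗ₘ g)) where
  hom_counit := by
    rw [Comon.tensorObj_counit, Category.assoc, tensorHom_comp_tensorHom_assoc,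
      IsComonHom.hom_counit, IsComonHom.hom_counit, counit_comul_hom_assoc]
    simp
  hom_comul := by
    rw [Comon.tensorObj_comul, Category.assoc, tensorHom_comp_tensorHom_assoc,
      IsComonHom.hom_comul, IsComonHom.hom_comul]
    have comm' : Δ[T] ≫ f ▷ T ≫ A ◁ g ≫ (β_ A H).hom = Δ[T] ≫ g ▷ T ≫ H ◁ f := by
      simpa [MonoidalCategory.tensorHom_def] using comm
    simp only [MonoidalCategory.tensorHom_def, tensorμ]
    calc
      _ = 𝟙 _ ⊗≫ (Δ[T] ≫ Δ[T] ▷ T) ⊗≫ f ▷ T ▷ T ⊗≫ A ◁ (f ▷ T ≫ A ◁ Δ[T]) ⊗≫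
            A ◁ A ◁ g ▷ T ⊗≫ ((A ⊗ A ⊗ H) ◁ g ≫ (A ◁ (β_ A H).hom) ▷ H) ⊗≫ 𝟙 _ := by monoidal
      _ = 𝟙 _ ⊗≫ Δ[T] ⊗≫ (T ◁ Δ[T] ≫ f ▷ (T ⊗ T)) ⊗≫ A ◁ T ◁ Δ[T] ⊗≫ A ◁ f ▷ T ▷ T ⊗≫
            A ◁ A ◁ g ▷ T ⊗≫ A ◁ (β_ A H).hom ▷ T ⊗≫ A ◁ H ◁ A ◁ g ⊗≫ 𝟙 _ := by
        rw [comul_assoc_flip, whisker_exchange, ← whisker_exchange f]; monoidal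
      _ = 𝟙 _ ⊗≫ Δ[T] ⊗≫ f ▷ T ⊗≫ A ◁ (Δ[T] ≫ T ◁ Δ[T]) ⊗≫ A ◁ f ▷ T ▷ T ⊗≫
            A ◁ A ◁ g ▷ T ⊗≫ A ◁ (β_ A H).hom ▷ T ⊗≫ A ◁ H ◁ A ◁ g ⊗≫ 𝟙 _ := by
        rw [whisker_exchange]; monoidal
      _ = 𝟙 _ ⊗≫ Δ[T] ⊗≫ f ▷ T ⊗≫ A ◁ Δ[T] ⊗≫ A ◁ (Δ[T] ≫ f ▷ T ≫ A ◁ g ≫ (β_ A H).hom) ▷ T ⊗≫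
            A ◁ H ◁ A ◁ g ⊗≫ 𝟙 _ := by
        rw [comul_assoc]; monoidal
      _ = 𝟙 _ ⊗≫ Δ[T] ⊗≫ f ▷ T ⊗≫ A ◁ (Δ[T] ≫ Δ[T] ▷ T ≫ (α_ T T T).hom) ⊗≫ A ◁ g ▷ (T ⊗ T) ⊗≫
            A ◁ H ◁ f ▷ T ⊗≫ A ◁ H ◁ A ◁ g ⊗≫ 𝟙 _ := by
        rw [comm']; monoidal
      _ = 𝟙 _ ⊗≫ Δ[T] ⊗≫ (f ▷ T ≫ A ◁ Δ[T]) ⊗≫ A ◁ (T ◁ Δ[T] ≫ g ▷ (T ⊗ T)) ⊗≫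
            A ◁ H ◁ f ▷ T ⊗≫ A ◁ H ◁ A ◁ g ⊗≫ 𝟙 _ := by
        rw [← comul_assoc]; monoidal
      _ = 𝟙 _ ⊗≫ (Δ[T] ≫ T ◁ Δ[T]) ⊗≫ f ▷ T ▷ T ⊗≫ A ◁ g ▷ T ⊗≫ A ◁ H ◁ Δ[T] ⊗≫
            A ◁ H ◁ f ▷ T ⊗≫ A ◁ H ◁ A ◁ g ⊗≫ 𝟙 _ := by
        rw [whisker_exchange g, ← whisker_exchange f]; monoidal
      _ = _ := by rw [comul_assoc]; monoidal

section

variable [ComonObj A] [ComonObj H] {φ : H ⊗ A ⟶ A} {ϕ : H ⊗ A ⟶ H}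

/-- `(h, a) ↦ φ(h₁, a₁) ⊗ ϕ(h₂, a₂)`. -/
abbrev psi (φ : H ⊗ A ⟶ A) (ϕ : H ⊗ A ⟶ H) : H ⊗ A ⟶ A ⊗ H := Δ[H ⊗ A] ≫ (φ ⊗ₘ ϕ)

lemma comul_tensor_comp {V W : C} (F : H ⊗ A ⟶ V) (G : H ⊗ A ⟶ W) :
    Δ[H ⊗ A] ≫ (F ⊗ₘ G) = H ◁ Δ[A] ≫ pair F G := by
  rw [pair_eq, Comon.tensorObj_comul, MonoidalCategory.tensorHom_def']; simp

lemma one_psi {eH : 𝟙_ C ⟶ H} (counit : eH ≫ ε[H] = 𝟙 _)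
    (comul : eH ≫ Δ[H] = (λ_ _).inv ≫ (eH ⊗ₘ eH)) (hφ : eH ▷ A ≫ φ = (λ_ A).hom)
    (hϕ : eH ▷ A ≫ ϕ = (λ_ A).hom ≫ ε[A] ≫ eH) :
    eH ▷ A ≫ psi φ ϕ = (λ_ A).hom ≫ (ρ_ A).inv ≫ A ◁ eH := by
  let _ := ComonObj.instTensorUnit C
  have : IsComonHom eH := ⟨counit, comul⟩
  have h₁ : eH ▷ A ≫ hat φ = (λ_ A).hom ≫ (ρ_ A).inv ≫ A ◁ eH := by
    rw [whiskerRight_hat, hφ, hat, ComonObj.instTensorUnit_comul, braiding_tensorUnit_left]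
    monoidal
  rw [psi, comul_tensor_comp, pair]
  calc
    _ = 𝟙 _ ⊗≫ (eH ▷ A ≫ H ◁ Δ[A]) ⊗≫ hat φ ▷ A ⊗≫ A ◁ ϕ := by monoidal
    _ = 𝟙 _ ⊗≫ Δ[A] ⊗≫ (eH ▷ A ≫ hat φ) ▷ A ⊗≫ A ◁ ϕ := by
      rw [← whisker_exchange]; monoidal
    _ = 𝟙 _ ⊗≫ Δ[A] ⊗≫ A ◁ (eH ▷ A ≫ ϕ) := by rw [h₁]; monoidal
    _ = 𝟙 _ ⊗≫ (Δ[A] ≫ A ◁ ε[A]) ⊗≫ A ◁ eH := by rw [hϕ]; monoidal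
    _ = _ := by rw [comul_counit]; monoidal

lemma psi_one {eA : 𝟙_ C ⟶ A} (comul : eA ≫ Δ[A] = (λ_ _).inv ≫ (eA ⊗ₘ eA))
    (hφ : H ◁ eA ≫ φ = (ρ_ H).hom ≫ ε[H] ≫ eA) (hϕ : H ◁ eA ≫ ϕ = (ρ_ H).hom) :
    H ◁ eA ≫ psi φ ϕ = (ρ_ H).hom ≫ (λ_ H).inv ≫ eA ▷ H := by
  rw [psi, comul_tensor_comp, ← MonoidalCategory.whiskerLeft_comp_assoc, comul,
    MonoidalCategory.whiskerLeft_comp_assoc, pair_naturality, hφ, hϕ, pair, ← Category.assoc,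
    hat_comp, hat, braiding_tensorUnit_right]
  calc
    _ = 𝟙 _ ⊗≫ (Δ[H] ≫ ε[H] ▷ H) ⊗≫ eA ▷ H := by monoidal
    _ = _ := by rw [counit_comul]; monoidal

/-- `psi φ ϕ` is `hat φ` followed by `ϕ` on a second copy of `A` (`h₃`). The module axiom for `φ`
gives the law for `hat φ` (`h₁`), `hϕ` handles the other leg, and `h₂` duplicates the output of `hat
φ` so that the inner `psi` can be reassembled. -/
lemma mul_psi {mH : H ⊗ H ⟶ H} [IsComonHom mH] [IsComonHom φ]
    (hφ : mH ▷ A ≫ φ = (α_ H H A).hom ≫ H ◁ φ ≫ φ)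
    (hϕ : mH ▷ A ≫ ϕ = (α_ H H A).hom ≫ H ◁ psi φ ϕ ≫ (α_ H A H).inv ≫ ϕ ▷ H ≫ mH) :
    mH ▷ A ≫ psi φ ϕ = (α_ H H A).hom ≫ H ◁ psi φ ϕ ≫ (α_ H A H).inv ≫ psi φ ϕ ▷ H ≫
      (α_ A H H).hom ≫ A ◁ mH := by
  have h₁ : mH ▷ A ≫ hat φ = (α_ H H A).hom ≫ H ◁ hat φ ≫ (α_ H A H).inv ≫ hat φ ▷ H ≫
      (α_ A H H).hom ≫ A ◁ mH := by
    rw [whiskerRight_hat, hφ, hat_tensor]; simp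
  have h₂ : hat φ ≫ Δ[A] ▷ H = H ◁ Δ[A] ≫ (α_ H A A).inv ≫ hat φ ▷ A ≫ (α_ A H A).hom ≫
      A ◁ hat φ ≫ (α_ A A H).inv := by
    rw [← hat_comp, IsComonHom.hom_comul, comul_tensor_comp, ← whiskerLeft_hat, hat_pair]
  have h₃ : psi φ ϕ = H ◁ Δ[A] ≫ (α_ H A A).inv ≫ hat φ ▷ A ≫ (α_ A H A).hom ≫ A ◁ ϕ := by
    rw [psi, comul_tensor_comp, pair]
  calc
    _ = 𝟙 _ ⊗≫ (mH ▷ A ≫ H ◁ Δ[A]) ⊗≫ hat φ ▷ A ⊗≫ A ◁ ϕ := by rw [h₃]; monoidal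
    _ = 𝟙 _ ⊗≫ (H ⊗ H) ◁ Δ[A] ⊗≫ (mH ▷ A ≫ hat φ) ▷ A ⊗≫ A ◁ ϕ := by
      rw [← whisker_exchange]; monoidal
    _ = 𝟙 _ ⊗≫ (H ⊗ H) ◁ Δ[A] ⊗≫ H ◁ hat φ ▷ A ⊗≫ hat φ ▷ (H ⊗ A) ⊗≫ A ◁ (mH ▷ A ≫ ϕ) := by
      rw [h₁]; monoidal
    _ = 𝟙 _ ⊗≫ (H ⊗ H) ◁ Δ[A] ⊗≫ H ◁ hat φ ▷ A ⊗≫ (hat φ ▷ (H ⊗ A) ≫ (A ⊗ H) ◁ (H ◁ Δ[A])) ⊗≫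
          A ◁ H ◁ hat φ ▷ A ⊗≫ A ◁ H ◁ A ◁ ϕ ⊗≫ A ◁ (ϕ ▷ H ≫ mH) := by
      rw [hϕ, h₃]; monoidal
    _ = 𝟙 _ ⊗≫ H ◁ H ◁ Δ[A] ⊗≫ H ◁ (hat φ ▷ A ≫ (A ⊗ H) ◁ Δ[A]) ⊗≫
          (hat φ ▷ (H ⊗ A ⊗ A) ≫ (A ⊗ H) ◁ ((α_ H A A).inv ≫ hat φ ▷ A)) ⊗≫
            A ◁ H ◁ A ◁ ϕ ⊗≫ A ◁ (ϕ ▷ H ≫ mH) := by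
      rw [← whisker_exchange]; monoidal
    _ = 𝟙 _ ⊗≫ H ◁ H ◁ (Δ[A] ≫ A ◁ Δ[A]) ⊗≫ H ◁ hat φ ▷ (A ⊗ A) ⊗≫ H ◁ A ◁ hat φ ▷ A ⊗≫
          (hat φ ▷ (A ⊗ (H ⊗ A)) ≫ (A ⊗ H) ◁ (A ◁ ϕ)) ⊗≫ A ◁ (ϕ ▷ H ≫ mH) := by
      rw [← whisker_exchange, ← whisker_exchange]; monoidal
    _ = 𝟙 _ ⊗≫ H ◁ H ◁ Δ[A] ⊗≫ H ◁ (H ◁ Δ[A] ≫ (α_ H A A).inv ≫ hat φ ▷ A ≫ (α_ A H A).hom ≫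
          A ◁ hat φ ≫ (α_ A A H).inv) ▷ A ⊗≫
            H ◁ (A ⊗ A) ◁ ϕ ⊗≫ hat φ ▷ (A ⊗ H) ⊗≫ A ◁ (ϕ ▷ H ≫ mH) := by
      rw [← whisker_exchange, comul_assoc]; monoidal
    _ = 𝟙 _ ⊗≫ H ◁ H ◁ Δ[A] ⊗≫ H ◁ hat φ ▷ A ⊗≫ H ◁ (Δ[A] ▷ (H ⊗ A) ≫ (A ⊗ A) ◁ ϕ) ⊗≫
          hat φ ▷ (A ⊗ H) ⊗≫ A ◁ (ϕ ▷ H ≫ mH) := by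
      rw [← h₂]; monoidal
    _ = _ := by rw [← whisker_exchange, h₃]; monoidal

/-- Here `φ(h, a b) = φ(h₁, a₁) φ(ϕ(h₂, a₂), b)` is a convolution action of `φ`. As `ϕ` is a
comonoid map, the two legs then depend on a single `ϕ(h₂, a₂)`, to which `psi` is applied again. -/
lemma psi_mul {mA : A ⊗ A ⟶ A} [IsComonHom mA] [IsComonHom ϕ]
    (hφ : H ◁ mA ≫ φ = (α_ H A A).inv ≫ psi φ ϕ ▷ A ≫ (α_ A H A).hom ≫ A ◁ φ ≫ mA)
    (hϕ : H ◁ mA ≫ ϕ = (α_ H A A).inv ≫ ϕ ▷ A ≫ ϕ) :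
    H ◁ mA ≫ psi φ ϕ = (α_ H A A).inv ≫ psi φ ϕ ▷ A ≫ (α_ A H A).hom ≫ A ◁ psi φ ϕ ≫
      (α_ A A H).inv ≫ mA ▷ H := by
  have hφ' : H ◁ mA ≫ φ = (α_ H A A).inv ≫ lact mA φ (ϕ ▷ A ≫ φ) := by
    rw [hφ, lact, psi]; simp only [MonoidalCategory.tensorHom_def]; monoidal
  have h₃ : psi φ ϕ = H ◁ Δ[A] ≫ pair φ ϕ := by rw [psi, comul_tensor_comp]
  have h₄ : H ◁ mA ≫ psi φ ϕ = (α_ H A A).inv ≫ (H ⊗ A) ◁ Δ[A] ≫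
      pair (lact mA φ (ϕ ▷ A ≫ φ)) (ϕ ▷ A ≫ ϕ) := by
    rw [psi, IsComonHom.hom_comul_assoc, tensorHom_comp_tensorHom, hφ', hϕ, ← comul_tensor_comp,
      IsComonHom.hom_comul_assoc, tensorHom_comp_tensorHom]
  have h₅ : pair (lact mA φ (ϕ ▷ A ≫ φ)) (ϕ ▷ A ≫ ϕ) =
      Δ[H ⊗ A] ▷ (A ⊗ A) ≫ (α_ _ _ _).hom ≫ (φ ⊗ₘ (ϕ ▷ (A ⊗ A) ≫ pair φ ϕ)) ≫
        (α_ A A H).inv ≫ mA ▷ H := by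
    rw [whiskerRight_pair, pair, hat_lact, pair]
    simp only [MonoidalCategory.tensorHom_def]
    calc
      _ = 𝟙 _ ⊗≫ Δ[H ⊗ A] ▷ A ▷ A ⊗≫ φ ▷ ((H ⊗ A) ⊗ A ⊗ A) ⊗≫ A ◁ hat (ϕ ▷ A ≫ φ) ▷ A ⊗≫
            (mA ▷ ((H ⊗ A) ⊗ A) ≫ A ◁ (ϕ ▷ A ≫ ϕ)) := by monoidal
      _ = _ := by rw [← whisker_exchange]; monoidal
  rw [h₄, h₅]
  calc
    _ = 𝟙 _ ⊗≫ ((H ⊗ A) ◁ Δ[A] ≫ psi φ ϕ ▷ (A ⊗ A)) ⊗≫ A ◁ pair φ ϕ ⊗≫ mA ▷ H := by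
      simp only [psi, MonoidalCategory.tensorHom_def]; monoidal
    _ = 𝟙 _ ⊗≫ psi φ ϕ ▷ A ⊗≫ A ◁ (H ◁ Δ[A] ≫ pair φ ϕ) ⊗≫ mA ▷ H := by
      rw [whisker_exchange]; monoidal
    _ = _ := by rw [← h₃]; monoidal

end
end Bicrossed

/-! ### Twisted and bicrossed products are Hopf algebras. -/

section BicrossedHopf

variable {C : Type u} [Category.{v} C] [MonoidalCategory C] [BraidedCategory C]

/-- The coalgebra underlying a Hopf algebra. -/
abbrev HopfData.IsHopf.comonObj {X : C} {h : HopfData X} (H : h.IsHopf) : ComonObj X where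
  counit := h.counit
  comul := h.comul
  counit_comul := H.counit_comul
  comul_counit := H.comul_counit
  comul_assoc := H.comul_assoc

variable {A H : C} {a : HopfData A} {h : HopfData H}

lemma Psi_eq (ha : a.IsHopf) (hh : h.IsHopf) (φ : H ⊗ A ⟶ A) (ϕ : H ⊗ A ⟶ H) :
    Psi a h φ ϕ = letI := ha.comonObj; letI := hh.comonObj; psi φ ϕ := by
  let _ := ha.comonObj
  let _ := hh.comonObj
  simp only [psi, Psi, Comon.tensorObj_comul, Category.assoc]
  rfl

section

variable [ComonObj A] [ComonObj H]

/-- The projection to the first factor of a tensor product of comonoids. -/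
def fstHom (A H : C) [ComonObj H] : A ⊗ H ⟶ A := A ◁ ε[H] ≫ (ρ_ A).hom

/-- The projection to the second factor of a tensor product of comonoids. -/
def sndHom (A H : C) [ComonObj A] : A ⊗ H ⟶ H := ε[A] ▷ H ≫ (λ_ H).hom

section

attribute [local instance] ComonObj.instTensorUnit

instance isComonHom_rightUnitor : IsComonHom (ρ_ A).hom where
  hom_counit := by
    rw [Comon.tensorObj_counit, ComonObj.instTensorUnit_counit, tensorHom_id,
      unitors_equal, rightUnitor_naturality]
  hom_comul := by
    rw [Comon.tensorObj_comul, ComonObj.instTensorUnit_comul, MonoidalCategory.tensorHom_def,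
      Category.assoc, Category.assoc, ← tensor_right_unitality, rightUnitor_naturality]

instance isComonHom_leftUnitor : IsComonHom (λ_ A).hom where
  hom_counit := by
    rw [Comon.tensorObj_counit, ComonObj.instTensorUnit_counit, id_tensorHom,
      leftUnitor_naturality]
  hom_comul := by
    rw [Comon.tensorObj_comul, ComonObj.instTensorUnit_comul, MonoidalCategory.tensorHom_def',
      Category.assoc, Category.assoc, ← tensor_left_unitality, leftUnitor_naturality]

instance isComonHom_counit : IsComonHom ε[A] where
  hom_counit := by simp
  hom_comul := by simp [unitors_inv_equal]

instance isComonHom_fstHom : IsComonHom (fstHom A H) := by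
  rw [fstHom]; infer_instance

instance isComonHom_sndHom : IsComonHom (sndHom A H) := by
  rw [sndHom]; infer_instance

lemma isComonHom_inl {h : HopfData H} [IsComonHom h.one] : IsComonHom (inl A h) := by
  rw [inl]; infer_instance

lemma isComonHom_inr {a : HopfData A} [IsComonHom a.one] : IsComonHom (inr H a) := by
  rw [inr]; infer_instance

lemma isComonHom_twistedProduct_one {a : HopfData A} {h : HopfData H} {Ψ : H ⊗ A ⟶ A ⊗ H}
    [IsComonHom a.one] [IsComonHom h.one] : IsComonHom (twistedProduct a h Ψ).one := by
  rw [twistedProduct]; dsimp only; infer_instance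

end

lemma comul_fst_snd : Δ[A ⊗ H] ≫ (fstHom A H ⊗ₘ sndHom A H) = 𝟙 _ := by
  rw [fstHom, sndHom, ← tensorHom_comp_tensorHom, ← id_tensorHom, ← tensorHom_id,
    Comon.tensorObj_comul, Category.assoc, ← tensorμ_natural_assoc,
    tensorHom_comp_tensorHom_assoc, id_tensorHom, tensorHom_id, comul_counit, counit_comul, tensorμ,
    braiding_tensorUnit_left]
  monoidal

lemma comul_snd_fst : Δ[A ⊗ H] ≫ (sndHom A H ⊗ₘ fstHom A H) = (β_ A H).hom := by
  rw [fstHom, sndHom, ← tensorHom_comp_tensorHom, ← id_tensorHom, ← tensorHom_id,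
    Comon.tensorObj_comul, Category.assoc, ← tensorμ_natural_assoc,
    tensorHom_comp_tensorHom_assoc, id_tensorHom, tensorHom_id, comul_counit, counit_comul, tensorμ]
  monoidal

end

/-- For the antipode: the identity is the convolution product of the two projections followed by the
inclusions, and the proposed antipode is the product of their inverses in reverse order. So the
check is `(f g)⁻¹ = g⁻¹ f⁻¹` in the convolution algebra. -/
lemma IsDistributive.isHopf {Ψ : H ⊗ A ⟶ A ⊗ H} (ha : a.IsHopf) (hh : h.IsHopf)
    (hΨ : IsDistributive a h Ψ)
    (hom : letI := ha.comonObj; letI := hh.comonObj; IsComonHom Ψ) :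
    (twistedProduct a h Ψ).IsHopf := by
  let _ := ha.comonObj
  let _ := hh.comonObj
  have _ : IsComonHom Ψ := hom
  have _ : IsComonHom a.mul :=
    ⟨ha.mul_counit, by rw [Comon.tensorObj_comul, Category.assoc]; exact ha.mul_comul⟩
  have _ : IsComonHom h.mul :=
    ⟨hh.mul_counit, by rw [Comon.tensorObj_comul, Category.assoc]; exact hh.mul_comul⟩
  have hmul : IsComonHom (twistedProduct a h Ψ).mul := by
    rw [twistedProduct_mul]; infer_instance
  let _ : ComonObj (𝟙_ C) := ComonObj.instTensorUnit C
  have _ : IsComonHom a.one := ⟨ha.one_counit, ha.one_comul⟩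
  have _ : IsComonHom h.one := ⟨hh.one_counit, hh.one_comul⟩
  have hone : IsComonHom (twistedProduct a h Ψ).one := isComonHom_twistedProduct_one
  have comul_eq : (twistedProduct a h Ψ).comul = Δ[A ⊗ H] := (Comon.tensorObj_comul A H).symm
  have counit_eq : (twistedProduct a h Ψ).counit = ε[A ⊗ H] := rfl
  have assoc := hΨ.mul_assoc ha.mul_assoc hh.mul_assoc
  have one_mul := hΨ.one_mul ha.one_mul hh.one_mul
  have mul_one := hΨ.mul_one ha.mul_one hh.mul_one
  set m := (twistedProduct a h Ψ).mul with hm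
  set e := (twistedProduct a h Ψ).one with he
  have conv_id : conv m (fstHom A H ≫ inl A h) (sndHom A H ≫ inr H a) = 𝟙 _ := by
    rw [conv, ← tensorHom_comp_tensorHom_assoc, hΨ.inl_mul_inr hh.one_mul ha.mul_one,
      reassoc_of% comul_fst_snd]
  have conv_antipode : conv m (sndHom A H ≫ h.antipode ≫ inr H a)
      (fstHom A H ≫ a.antipode ≫ inl A h) = (twistedProduct a h Ψ).antipode := by
    rw [conv, ← tensorHom_comp_tensorHom_assoc, reassoc_of% comul_snd_fst,
      ← tensorHom_comp_tensorHom_assoc, inr_mul_inl ha.one_mul hh.mul_one]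
    rfl
  have hinl := hΨ.inl_mul_inl hh.one_mul
  have hinr := hΨ.inr_mul_inr ha.mul_one
  have one_inl' : a.one ≫ inl A h = e := one_inl
  have one_inr' : h.one ≫ inr H a = e := one_inr
  have ha₁ : conv a.mul a.antipode (𝟙 A) = ε[A] ≫ a.one := by
    rw [conv, tensorHom_id]; exact ha.antipode_left
  have ha₂ : conv a.mul (𝟙 A) a.antipode = ε[A] ≫ a.one := by
    rw [conv, id_tensorHom]; exact ha.antipode_right
  have hh₁ : conv h.mul h.antipode (𝟙 H) = ε[H] ≫ h.one := by
    rw [conv, tensorHom_id]; exact hh.antipode_left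
  have hh₂ : conv h.mul (𝟙 H) h.antipode = ε[H] ≫ h.one := by
    rw [conv, id_tensorHom]; exact hh.antipode_right
  have fst_left : conv m (fstHom A H ≫ a.antipode ≫ inl A h) (fstHom A H ≫ inl A h) =
      ε[A ⊗ H] ≫ e := by
    rw [← comp_conv, ← one_inl', ← IsComonHom.hom_counit (fstHom A H), Category.assoc,
      ← reassoc_of% ha₁, conv_comp hinl, Category.id_comp]
  have fst_right : conv m (fstHom A H ≫ inl A h) (fstHom A H ≫ a.antipode ≫ inl A h) =
      ε[A ⊗ H] ≫ e := by
    rw [← comp_conv, ← one_inl', ← IsComonHom.hom_counit (fstHom A H), Category.assoc,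
      ← reassoc_of% ha₂, conv_comp hinl, Category.id_comp]
  have snd_left : conv m (sndHom A H ≫ h.antipode ≫ inr H a) (sndHom A H ≫ inr H a) =
      ε[A ⊗ H] ≫ e := by
    rw [← comp_conv, ← one_inr', ← IsComonHom.hom_counit (sndHom A H), Category.assoc,
      ← reassoc_of% hh₁, conv_comp hinr, Category.id_comp]
  have snd_right : conv m (sndHom A H ≫ inr H a) (sndHom A H ≫ h.antipode ≫ inr H a) =
      ε[A ⊗ H] ≫ e := by
    rw [← comp_conv, ← one_inr', ← IsComonHom.hom_counit (sndHom A H), Category.assoc,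
      ← reassoc_of% hh₂, conv_comp hinr, Category.id_comp]
  refine ⟨one_mul, mul_one, assoc, ?_, ?_, ?_, ?_, ?_, ?_, ?_, ?_, ?_⟩
  · rw [comul_eq, counit_eq, counit_comul]
  · rw [comul_eq, counit_eq, comul_counit]
  · rw [comul_eq, comul_assoc]
  · rw [counit_eq]; exact hone.hom_counit
  · rw [comul_eq]; exact hone.hom_comul
  · rw [counit_eq]; exact hmul.hom_counit
  · rw [comul_eq]
    have := hmul.hom_comul
    rw [Comon.tensorObj_comul (A ⊗ H) (A ⊗ H), Category.assoc] at this
    exact this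
  · rw [comul_eq, counit_eq, ← tensorHom_id, ← hm, ← he]
    change conv m _ _ = _
    rw [← conv_antipode, ← conv_id, conv_assoc assoc, ← conv_assoc assoc (fstHom A H ≫ _),
      fst_left, one_conv one_mul, snd_left]
  · rw [comul_eq, counit_eq, ← id_tensorHom, ← hm, ← he]
    change conv m _ _ = _
    rw [← conv_antipode, ← conv_id, conv_assoc assoc, ← conv_assoc assoc (sndHom A H ≫ _),
      snd_right, one_conv one_mul, fst_right]

lemma IsMatchedPair.isComonHom_left {φ : H ⊗ A ⟶ A} {ϕ : H ⊗ A ⟶ H}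
    (P : IsMatchedPair a h φ ϕ) :
    letI := P.isHopf_left.comonObj; letI := P.isHopf_right.comonObj; IsComonHom φ := by
  let _ := P.isHopf_left.comonObj
  let _ := P.isHopf_right.comonObj
  refine ⟨P.leftModuleCoalgebra.act_counit, ?_⟩
  rw [comul_tensor_comp, pair_eq]
  exact P.leftModuleCoalgebra.act_comul

lemma IsMatchedPair.isComonHom_right {φ : H ⊗ A ⟶ A} {ϕ : H ⊗ A ⟶ H}
    (P : IsMatchedPair a h φ ϕ) :
    letI := P.isHopf_left.comonObj; letI := P.isHopf_right.comonObj; IsComonHom ϕ := by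
  let _ := P.isHopf_left.comonObj
  let _ := P.isHopf_right.comonObj
  refine ⟨P.rightModuleCoalgebra.act_counit, ?_⟩
  rw [Comon.tensorObj_comul, MonoidalCategory.tensorHom_def, Category.assoc, Category.assoc]
  exact P.rightModuleCoalgebra.act_comul

lemma IsMatchedPair.isDistributive {φ : H ⊗ A ⟶ A} {ϕ : H ⊗ A ⟶ H} (P : IsMatchedPair a h φ ϕ) :
    IsDistributive a h (Psi a h φ ϕ) := by
  let _ := P.isHopf_left.comonObj
  let _ := P.isHopf_right.comonObj
  have _ : IsComonHom a.mul :=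
    ⟨P.isHopf_left.mul_counit, by
      rw [Comon.tensorObj_comul, Category.assoc]; exact P.isHopf_left.mul_comul⟩
  have _ : IsComonHom h.mul :=
    ⟨P.isHopf_right.mul_counit, by
      rw [Comon.tensorObj_comul, Category.assoc]; exact P.isHopf_right.mul_comul⟩
  have _ := P.isComonHom_left
  have _ := P.isComonHom_right
  have hΨ : Psi a h φ ϕ = psi φ ϕ := Psi_eq P.isHopf_left P.isHopf_right φ ϕ
  have hleft := P.left_mul
  have hright := P.right_mul
  rw [hΨ] at *
  exact
    { one_left := one_psi P.isHopf_right.one_counit P.isHopf_right.one_comul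
        P.leftModuleCoalgebra.one_act P.right_one
      one_right := psi_one P.isHopf_left.one_comul P.left_one P.rightModuleCoalgebra.act_one
      mul_left := mul_psi P.leftModuleCoalgebra.mul_act hright
      mul_right := psi_mul hleft P.rightModuleCoalgebra.act_mul }

theorem IsMatchedPair.isHopf {φ : H ⊗ A ⟶ A} {ϕ : H ⊗ A ⟶ H} (P : IsMatchedPair a h φ ϕ) :
    (bicrossed a h φ ϕ).IsHopf := by
  refine P.isDistributive.isHopf P.isHopf_left P.isHopf_right ?_
  rw [Psi_eq P.isHopf_left P.isHopf_right]
  let _ := P.isHopf_left.comonObj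
  let _ := P.isHopf_right.comonObj
  have _ := P.isComonHom_left
  have _ := P.isComonHom_right
  refine isComonHom_lift φ ϕ ?_
  have := P.twist
  rw [Psi_eq P.isHopf_left P.isHopf_right, psi, Category.assoc] at this
  rw [this, Comon.tensorObj_comul, Category.assoc]
  rfl

end BicrossedHopf

/-! ### The smash product as a bicrossed product. -/

section Smash

variable {C : Type u} [Category.{v} C] [MonoidalCategory C] {A H : C}

lemma hat_rightUnitor_counit [BraidedCategory C] [ComonObj H] :
    hat ((ρ_ H).hom ≫ ε[H]) = (ρ_ H).hom ≫ (λ_ H).inv := by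
  rw [hat, braiding_tensorUnit_right]
  calc
    _ = 𝟙 _ ⊗≫ (Δ[H] ≫ ε[H] ▷ H) ⊗≫ 𝟙 _ := by monoidal
    _ = _ := by rw [counit_comul]; monoidal

lemma psi_fstHom [BraidedCategory C] [ComonObj A] [ComonObj H] (φ : H ⊗ A ⟶ A) :
    psi φ (fstHom H A) = hat φ := by
  rw [psi, comul_tensor_comp, pair, fstHom]
  calc
    _ = 𝟙 _ ⊗≫ H ◁ Δ[A] ⊗≫ (hat φ ▷ A ≫ (A ⊗ H) ◁ ε[A]) ⊗≫ 𝟙 _ := by monoidal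
    _ = 𝟙 _ ⊗≫ H ◁ (Δ[A] ≫ A ◁ ε[A]) ⊗≫ hat φ ⊗≫ 𝟙 _ := by rw [← whisker_exchange]; monoidal
    _ = _ := by rw [comul_counit]; monoidal

lemma comul_fstHom [BraidedCategory C] [ComonObj A] [ComonObj H] (φ : H ⊗ A ⟶ A) :
    Δ[H ⊗ A] ≫ (fstHom H A ⊗ₘ φ) = Δ[H] ▷ A ≫ (α_ H H A).hom ≫ H ◁ φ := by
  rw [Comon.tensorObj_comul, fstHom]
  simp only [tensorμ, MonoidalCategory.tensorHom_def]
  calc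
    _ = 𝟙 _ ⊗≫ Δ[H] ▷ A ⊗≫ H ◁ H ◁ Δ[A] ⊗≫ H ◁ ((β_ H A).hom ≫ ε[A] ▷ H) ▷ A ⊗≫
          H ◁ φ := by monoidal
    _ = 𝟙 _ ⊗≫ Δ[H] ▷ A ⊗≫ H ◁ H ◁ (Δ[A] ≫ ε[A] ▷ A) ⊗≫ H ◁ φ := by
      rw [← braiding_naturality_right, braiding_tensorUnit_right]; monoidal
    _ = _ := by rw [counit_comul]; monoidal

variable [SymmetricCategory C]

/-- The crossing of `H` with `A` occurs twice and cancels. This is the point where a braiding is not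
enough and the symmetry is needed. -/
lemma hat_braiding [ComonObj H] (φ : H ⊗ A ⟶ A) :
    hat φ ≫ (β_ A H).hom = (Δ[H] ≫ (β_ H H).hom) ▷ A ≫ (α_ H H A).hom ≫ H ◁ φ := by
  rw [hat]
  calc
    _ = 𝟙 _ ⊗≫ Δ[H] ▷ A ⊗≫ H ◁ (β_ H A).hom ⊗≫ (φ ▷ H ≫ (β_ A H).hom) := by monoidal
    _ = 𝟙 _ ⊗≫ Δ[H] ▷ A ⊗≫ H ◁ ((β_ H A).hom ≫ (β_ A H).hom) ⊗≫ (β_ H H).hom ▷ A ⊗≫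
          H ◁ φ := by
      rw [braiding_naturality_left, braiding_tensor_left_hom]; monoidal
    _ = _ := by rw [SymmetricCategory.symmetry]; monoidal

variable {a : HopfData A} {h : HopfData H}

lemma Psi_fstHom [ComonObj A] (ha : a.IsHopf) (hh : h.IsHopf) (φ : H ⊗ A ⟶ A)
    (counit : ε[A] = a.counit) :
    Psi a h φ (fstHom H A) = smashPsi h φ := by
  rw [Psi_eq ha hh, fstHom, counit]
  let _ := ha.comonObj
  let _ := hh.comonObj
  exact psi_fstHom φ

/-- With the trivial right action, `Ψ` becomes `hat φ`, the matched pair condition `left_mul`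
becomes the module algebra axiom, and `twist` becomes the cocommutativity class condition. -/
theorem isMatchedPair_fstHom (ha : a.IsHopf) (hh : h.IsHopf) {φ : H ⊗ A ⟶ A}
    (alg : IsLeftModuleAlgebra h a φ) (coalg : IsLeftModuleCoalgebra h a φ)
    (cocomm : InCocommutativityClass h φ) :
    letI := ha.comonObj; IsMatchedPair a h φ (fstHom H A) := by
  let _ := ha.comonObj
  let _ := hh.comonObj
  have hcomul : IsComonHom (fstHom H A) := inferInstance
  have hΨ : Psi a h φ (fstHom H A) = hat φ := Psi_fstHom ha hh φ rfl
  have comul_tensor : (h.comul ⊗ₘ a.comul) ≫ tensorμ H H A A = Δ[H ⊗ A] :=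
    (Comon.tensorObj_comul H A).symm
  have act_mul : H ◁ a.mul ≫ φ = pair φ φ ≫ a.mul := by
    rw [pair_eq, Category.assoc, Category.assoc]
    have := alg.act_mul
    rwa [diagLeft, Category.assoc, Category.assoc] at this
  have mul_counit : a.mul ≫ ε[A] = (ε[A] ⊗ₘ ε[A]) ≫ (λ_ (𝟙_ C)).hom := ha.mul_counit
  refine ⟨ha, hh, coalg, ⟨⟨?_, ?_⟩, ?_, ?_⟩, alg.act_one, ?_, ?_, ?_, ?_⟩
  · have : a.one ≫ ε[A] = 𝟙 _ := ha.one_counit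
    rw [fstHom, ← whiskerLeft_comp_assoc, this]; simp
  · rw [fstHom, ← whiskerLeft_comp_assoc, mul_counit, MonoidalCategory.tensorHom_def']
    calc
      _ = 𝟙 _ ⊗≫ H ◁ (A ◁ ε[A] ≫ ε[A] ▷ 𝟙_ C) ⊗≫ 𝟙 _ := by monoidal
      _ = _ := by rw [whisker_exchange]; monoidal
  · exact hcomul.hom_counit
  · refine hcomul.hom_comul.trans ?_
    rw [← comul_tensor, MonoidalCategory.tensorHom_def, Category.assoc, Category.assoc]
    rfl
  · rw [fstHom, ← whisker_exchange_assoc]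
    change _ = (λ_ A).hom ≫ ε[A] ≫ h.one
    simp [← unitors_equal]
  · rw [hΨ, act_mul, pair]; simp
  · rw [hΨ, fstHom]
    have h₁ : hat φ ≫ ε[A] ▷ H = H ◁ ε[A] ≫ (ρ_ H).hom ≫ (λ_ H).inv := by
      have h₂ : φ ≫ ε[A] = H ◁ ε[A] ≫ (ρ_ H).hom ≫ ε[H] := by
        refine coalg.act_counit.trans ?_
        change (ε[H] ⊗ₘ ε[A]) ≫ _ = _
        rw [MonoidalCategory.tensorHom_def', Category.assoc, unitors_equal,
          rightUnitor_naturality]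
      rw [← hat_comp, h₂, ← whiskerLeft_hat, hat_rightUnitor_counit]
    calc
      _ = 𝟙 _ ⊗≫ (h.mul ▷ A ≫ H ◁ ε[A]) ⊗≫ 𝟙 _ := by monoidal
      _ = 𝟙 _ ⊗≫ H ◁ (H ◁ ε[A] ≫ (ρ_ H).hom ≫ (λ_ H).inv) ⊗≫ h.mul := by
        rw [← whisker_exchange]; monoidal
      _ = _ := by rw [← h₁]; monoidal
  · rw [hΨ, reassoc_of% comul_tensor, comul_fstHom, hat_braiding]
    exact cocomm

lemma smash_isHopf (ha : a.IsHopf) (hh : h.IsHopf) {φ : H ⊗ A ⟶ A}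
    (alg : IsLeftModuleAlgebra h a φ) (coalg : IsLeftModuleCoalgebra h a φ)
    (cocomm : InCocommutativityClass h φ) : (smash a h φ).IsHopf := by
  let _ := ha.comonObj
  have := (isMatchedPair_fstHom ha hh alg coalg cocomm).isHopf
  rwa [bicrossed, Psi_fstHom ha hh φ rfl] at this

lemma smashPsi_isDistributive (ha : a.IsHopf) (hh : h.IsHopf) {φ : H ⊗ A ⟶ A}
    (alg : IsLeftModuleAlgebra h a φ) (coalg : IsLeftModuleCoalgebra h a φ)
    (cocomm : InCocommutativityClass h φ) : IsDistributive a h (smashPsi h φ) := by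
  let _ := ha.comonObj
  have := (isMatchedPair_fstHom ha hh alg coalg cocomm).isDistributive
  rwa [Psi_fstHom ha hh φ rfl] at this

end Smash

/-! ### The brace axiom as a measuring condition, tested on generators. -/

section Brace

variable {C : Type u} [Category.{v} C] [MonoidalCategory C] [BraidedCategory C]

lemma compat_iff_measuresAlong {X : C} [ComonObj X] {x₁ x₂ : HopfData X} (hx : x₁.IsHopf)
    (comul : x₁.comul = Δ[X]) (counit : x₁.counit = ε[X]) :
    X ◁ x₁.mul ≫ x₂.mul =
      x₁.comul ▷ (X ⊗ X) ≫ tensorμ X X X X ≫ (x₂.mul ⊗ₘ Gamma x₁ x₂) ≫ x₁.mul ↔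
    MeasuresAlong x₁.mul (lact x₁.mul x₁.antipode x₂.mul) (𝟙 X) := by
  rw [measuresAlong_lact_iff hx.mul_assoc hx.one_mul (i := 𝟙 X)
    (by rw [id_tensorHom, ← comul, ← counit]; exact hx.antipode_right)]
  rw [id_whiskerRight, whiskerLeft_id, Category.id_comp, Category.id_comp, pair_eq, Gamma, lact,
    comul]
  simp only [Category.assoc]

variable {X Y Z B : C} {m : B ⊗ B ⟶ B}

lemma MeasuresAlong.comp [ComonObj X] [ComonObj B] {G : B ⊗ B ⟶ B}
    (hG : MeasuresAlong m G (𝟙 B)) (i : X ⟶ B) [IsComonHom i] (j : Y ⟶ B) :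
    MeasuresAlong m (i ▷ B ≫ G) j := by
  unfold MeasuresAlong at *
  rw [id_whiskerRight, Category.id_comp, whiskerLeft_id, Category.id_comp] at hG
  have h₁ := pair_naturality j (𝟙 B) G G
  rw [tensorHom_id, whiskerLeft_id, Category.id_comp] at h₁
  rw [whisker_exchange_assoc, MonoidalCategory.whiskerLeft_comp_assoc, hG, reassoc_of% h₁,
    ← Category.assoc, whiskerRight_pair, whisker_exchange_assoc]

/-- Left convolution by `u` is injective if `u` has a left convolution inverse. -/
lemma lact_eq_of_lact_eq [ComonObj X] (hm : m ▷ B ≫ m = (α_ B B B).hom ≫ B ◁ m ≫ m)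
    {e : 𝟙_ C ⟶ B} (he : e ▷ B ≫ m = (λ_ B).hom) {i s : X ⟶ B}
    (h : conv m s i = ε[X] ≫ e) {K L : X ⊗ Z ⟶ B} (hK : lact m i K = L) :
    lact m s L = K := by
  rw [← hK, lact_lact hm]
  rw [conv] at h
  rw [h, lact_counit he]

lemma inv_right_of_isComonHom [ComonObj X] [ComonObj Y] {x : HopfData X} (hx : x.IsHopf)
    (comul : x.comul = Δ[X]) (counit : x.counit = ε[X]) (t : Y ⟶ X) [IsComonHom t] :
    conv x.mul t (t ≫ x.antipode) = ε[Y] ≫ x.one := by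
  have h : conv x.mul (𝟙 X) x.antipode = ε[X] ≫ x.one := by
    rw [conv, id_tensorHom, ← comul, ← counit]; exact hx.antipode_right
  have := t ≫= h
  rwa [comp_conv, Category.comp_id, IsComonHom.hom_counit_assoc] at this

lemma inv_left_of_isComonHom [ComonObj X] [ComonObj Y] {x : HopfData X} (hx : x.IsHopf)
    (comul : x.comul = Δ[X]) (counit : x.counit = ε[X]) (t : Y ⟶ X) [IsComonHom t] :
    conv x.mul (t ≫ x.antipode) t = ε[Y] ≫ x.one := by
  have h : conv x.mul x.antipode (𝟙 X) = ε[X] ≫ x.one := by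
    rw [conv, tensorHom_id, ← comul, ← counit]; exact hx.antipode_left
  have := t ≫= h
  rwa [comp_conv, Category.comp_id, IsComonHom.hom_counit_assoc] at this

variable {b₁ b₂ : HopfData B}

/-- It suffices to compare after convolving with `x ·₂ y` on the left: `(x₁ ·₂ y₁) ·₁ Γ(x₂, Γ(y₂,
b)) = x ·₂ (y₁ ·₁ Γ(y₂, b)) = x ·₂ (y ·₂ b) = (x ·₂ y) ·₂ b`. The first equality is the brace axiom
for `x` in the image of `i` (`hi'`), the second is the definition of `Γ` (`hL`). -/
lemma lact_mul_comp [ComonObj B] [ComonObj X] [ComonObj Y] (hb₁ : b₁.IsHopf) (hb₂ : b₂.IsHopf)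
    (comul : b₁.comul = Δ[B]) (counit : b₁.counit = ε[B])
    {i : X ⟶ B} {k : Y ⟶ B} [IsComonHom i] [IsComonHom k] [IsComonHom b₂.mul]
    (hi : MeasuresAlong b₁.mul (i ▷ B ≫ lact b₁.mul b₁.antipode b₂.mul) (𝟙 B)) :
    ((i ⊗ₘ k) ≫ b₂.mul) ▷ B ≫ lact b₁.mul b₁.antipode b₂.mul =
      (α_ X Y B).hom ≫ X ◁ (k ▷ B ≫ lact b₁.mul b₁.antipode b₂.mul) ≫
        i ▷ B ≫ lact b₁.mul b₁.antipode b₂.mul := by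
  set m := b₁.mul
  have inv_right {T : C} [ComonObj T] (t : T ⟶ B) [IsComonHom t] :=
    inv_right_of_isComonHom hb₁ comul counit t
  have hL {T : C} [ComonObj T] (t : T ⟶ B) [IsComonHom t] :
      lact m t (lact m (t ≫ b₁.antipode) (t ▷ B ≫ b₂.mul)) = t ▷ B ≫ b₂.mul := by
    have := inv_right t
    rw [conv] at this
    rw [lact_lact hb₁.mul_assoc, this, lact_counit hb₁.one_mul]
  rw [whiskerRight_lact, whiskerRight_lact, whiskerRight_lact]
  rw [whiskerRight_lact] at hi
  set Γi := lact m (i ≫ b₁.antipode) (i ▷ B ≫ b₂.mul) with hΓi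
  set Γk := lact m (k ≫ b₁.antipode) (k ▷ B ≫ b₂.mul) with hΓk
  have hi' : X ◁ m ≫ i ▷ B ≫ b₂.mul = pair (i ▷ B ≫ b₂.mul) Γi ≫ m := by
    have := inv_right i
    rw [conv] at this
    rw [measuresAlong_lact_iff hb₁.mul_assoc hb₁.one_mul this] at hi
    simpa using hi
  refine lact_eq_of_lact_eq hb₁.mul_assoc hb₁.one_mul (inv_left_of_isComonHom hb₁ comul counit _) ?_
  calc
    _ = (Δ[X ⊗ Y] ≫ (((i ⊗ₘ k) ≫ b₂.mul) ⊗ₘ 𝟙 _)) ▷ B ≫ (α_ _ _ _).hom ≫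
          B ◁ ((α_ X Y B).hom ≫ X ◁ Γk ≫ Γi) ≫ m := by
      simp only [lact, MonoidalCategory.tensorHom_def]; monoidal
    _ = (α_ X Y B).hom ≫ X ◁ (Δ[Y] ▷ B ≫ (α_ Y Y B).hom) ≫
          pair ((i ⊗ₘ k) ≫ b₂.mul) (X ◁ Γk ≫ Γi) ≫ m := by
      rw [comul_tensor_comp]; simp only [pair]; monoidal
    _ = (α_ X Y B).hom ≫ X ◁ (Δ[Y] ▷ B ≫ (α_ Y Y B).hom ≫ (k ⊗ₘ Γk)) ≫
          pair (i ▷ B ≫ b₂.mul) Γi ≫ m := by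
      have := pair_naturality k Γk (i ▷ B ≫ b₂.mul) Γi
      rw [MonoidalCategory.whiskerLeft_comp_assoc, MonoidalCategory.whiskerLeft_comp_assoc,
        MonoidalCategory.whiskerLeft_comp_assoc, reassoc_of% this,
        MonoidalCategory.tensorHom_def', Category.assoc]
    _ = (α_ X Y B).hom ≫ X ◁ lact m k Γk ≫ i ▷ B ≫ b₂.mul := by
      rw [← hi', lact]; simp only [MonoidalCategory.whiskerLeft_comp, Category.assoc]
    _ = _ := by
      rw [hΓk, hL, comp_whiskerRight_assoc, hb₂.mul_assoc, MonoidalCategory.whiskerLeft_comp,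
        MonoidalCategory.tensorHom_def']
      calc
        _ = 𝟙 _ ⊗≫ X ◁ (k ▷ B) ⊗≫ (X ◁ b₂.mul ≫ i ▷ B) ⊗≫ b₂.mul := by monoidal
        _ = _ := by rw [whisker_exchange]; monoidal

/-- If `B` is generated by `X` and `Y` for both products, the compatibility condition of a Hopf
brace on `B` may be checked on generators. -/
lemma measuresAlong_iff_of_generators [ComonObj X] [ComonObj Y] {b₁ b₂ : HopfData (X ⊗ Y)}
    (hb₁ : b₁.IsHopf) (hb₂ : b₂.IsHopf) (comul : b₁.comul = Δ[X ⊗ Y])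
    (counit : b₁.counit = ε[X ⊗ Y]) {i : X ⟶ X ⊗ Y} {k : Y ⟶ X ⊗ Y} [IsComonHom i] [IsComonHom k]
    [IsComonHom b₂.mul] (h₁ : (i ⊗ₘ k) ≫ b₁.mul = 𝟙 _) (h₂ : (i ⊗ₘ k) ≫ b₂.mul = 𝟙 _) :
    MeasuresAlong b₁.mul (lact b₁.mul b₁.antipode b₂.mul) (𝟙 (X ⊗ Y)) ↔
      (MeasuresAlong b₁.mul (i ▷ (X ⊗ Y) ≫ lact b₁.mul b₁.antipode b₂.mul) i ∧
      MeasuresAlong b₁.mul (i ▷ (X ⊗ Y) ≫ lact b₁.mul b₁.antipode b₂.mul) k) ∧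
      (MeasuresAlong b₁.mul (k ▷ (X ⊗ Y) ≫ lact b₁.mul b₁.antipode b₂.mul) i ∧
      MeasuresAlong b₁.mul (k ▷ (X ⊗ Y) ≫ lact b₁.mul b₁.antipode b₂.mul) k) := by
  have along_id {Z : C} [ComonObj Z] {F : Z ⊗ X ⊗ Y ⟶ X ⊗ Y} (hi : MeasuresAlong b₁.mul F i)
      (hk : MeasuresAlong b₁.mul F k) : MeasuresAlong b₁.mul F (𝟙 _) := by
    have := hi.mul hb₁.mul_assoc hk
    rwa [h₁] at this
  refine ⟨fun h => ⟨⟨h.comp i i, h.comp i k⟩, h.comp k i, h.comp k k⟩, ?_⟩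
  rintro ⟨⟨hii, hik⟩, hki, hkk⟩
  have hi := along_id hii hik
  -- The composite of the two measuring maps is `Γ` restricted along `(i ⊗ₘ k) ≫ b₂.mul`, which is
  -- the identity.
  have := measuresAlong_tensor hi (along_id hki hkk)
  rwa [← lact_mul_comp hb₁ hb₂ comul counit hi, h₂, id_whiskerRight, Category.id_comp] at this

end Brace

/-! ### The four generator cases and the conditions (C1), (C2), (C3). -/

section Conditions

variable {C : Type u} [Category.{v} C] [MonoidalCategory C] [BraidedCategory C]
variable {A H X Y Z V : C} {a₁ a₂ : HopfData A} {h₁ h₂ : HopfData H} {Ψ₁ Ψ₂ : H ⊗ A ⟶ A ⊗ H}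

lemma pair_inl_mul [ComonObj X] (hΨ : IsDistributive a₁ h₁ Ψ₁) (hh : h₁.IsHopf)
    (F : X ⊗ Y ⟶ A) (G : X ⊗ Z ⟶ A ⊗ H) :
    pair (F ≫ inl A h₁) G ≫ (twistedProduct a₁ h₁ Ψ₁).mul =
      pair F G ≫ (α_ A A H).inv ≫ a₁.mul ▷ H := by
  have := pair_comp (inl A h₁) (𝟙 _) F G
  rw [Category.comp_id, tensorHom_id] at this
  rw [← this, Category.assoc, hΨ.inl_mul hh.one_mul]

lemma pair_inr_mul [ComonObj X] (ha : a₁.IsHopf) (F : X ⊗ Y ⟶ H) (G : X ⊗ Z ⟶ A ⊗ H) :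
    pair (F ≫ inr H a₁) G ≫ (twistedProduct a₁ h₁ Ψ₁).mul =
      pair F G ≫ (α_ H A H).inv ≫ Ψ₁ ▷ H ≫ (α_ A H H).hom ≫ A ◁ h₁.mul := by
  have := pair_comp (inr H a₁) (𝟙 _) F G
  rw [Category.comp_id, tensorHom_id] at this
  rw [← this, Category.assoc, inr_mul ha.one_mul]

lemma pair_associator_inv [ComonObj X] (F : X ⊗ Y ⟶ V) (G : X ⊗ Z ⟶ A) :
    pair F ((α_ X Z H).inv ≫ G ▷ H) =
      X ◁ (α_ Y Z H).inv ≫ (α_ X (Y ⊗ Z) H).inv ≫ pair F G ▷ H ≫ (α_ V A H).hom := by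
  simp only [pair]; monoidal

lemma lact_inl [ComonObj X] (hΨ : IsDistributive a₁ h₁ Ψ₁) (hh : h₁.IsHopf) (u : X ⟶ A)
    (F : X ⊗ Y ⟶ A) :
    lact (twistedProduct a₁ h₁ Ψ₁).mul (u ≫ inl A h₁) ((α_ X Y H).inv ≫ F ▷ H) =
      (α_ X Y H).inv ≫ lact a₁.mul u F ▷ H := by
  rw [lact, MonoidalCategory.tensorHom_def', comp_whiskerRight]
  simp only [Category.assoc]
  rw [hΨ.inl_mul hh.one_mul, lact]
  simp only [MonoidalCategory.tensorHom_def']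
  monoidal

/-- Two maps into `A ⊗ H` agree if they agree after multiplication with a free variable in `H`. -/
lemma whiskerRight_mul_inj (hh : h₁.IsHopf) {f g : X ⟶ A ⊗ H}
    (e : f ▷ H ≫ (α_ A H H).hom ≫ A ◁ h₁.mul = g ▷ H ≫ (α_ A H H).hom ≫ A ◁ h₁.mul) :
    f = g := by
  -- Setting the free variable to the unit recovers `f`.
  have key (f : X ⟶ A ⊗ H) :
      (ρ_ X).inv ≫ X ◁ h₁.one ≫ f ▷ H ≫ (α_ A H H).hom ≫ A ◁ h₁.mul = f := by
    calc
      _ = 𝟙 _ ⊗≫ (X ◁ h₁.one ≫ f ▷ H) ⊗≫ A ◁ h₁.mul := by monoidal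
      _ = f ⊗≫ A ◁ (H ◁ h₁.one ≫ h₁.mul) := by rw [whisker_exchange]; monoidal
      _ = _ := by rw [hh.mul_one]; monoidal
  rw [← key f, e, key]

lemma whiskerRight_mul_inj_iff (hh : h₁.IsHopf) {f g : X ⟶ A ⊗ H} :
    f ▷ H ≫ (α_ A H H).hom ≫ A ◁ h₁.mul = g ▷ H ≫ (α_ A H H).hom ≫ A ◁ h₁.mul ↔ f = g :=
  ⟨whiskerRight_mul_inj hh, fun e => by rw [e]⟩

lemma hat_sndHom [ComonObj A] : hat (sndHom A H) = (β_ A H).hom := by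
  rw [hat, sndHom]
  calc
    _ = 𝟙 _ ⊗≫ Δ[A] ▷ H ⊗≫ (A ◁ (β_ A H).hom ≫ ε[A] ▷ (H ⊗ A)) ⊗≫ 𝟙 _ := by monoidal
    _ = 𝟙 _ ⊗≫ (Δ[A] ≫ ε[A] ▷ A) ▷ H ⊗≫ (β_ A H).hom ⊗≫ 𝟙 _ := by
      rw [whisker_exchange]; monoidal
    _ = _ := by rw [counit_comul]; monoidal

lemma Gamma_one [ComonObj A] (ha₁ : a₁.IsHopf) (ha₂ : a₂.IsHopf) (comul : a₁.comul = Δ[A])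
    (counit : a₁.counit = ε[A]) : A ◁ a₂.one ≫ Gamma a₁ a₂ = (ρ_ A).hom ≫ ε[A] ≫ a₁.one := by
  rw [Gamma, comul, MonoidalCategory.tensorHom_def']
  calc
    _ = 𝟙 _ ⊗≫ (A ◁ a₂.one ≫ Δ[A] ▷ A) ⊗≫ A ◁ a₂.mul ⊗≫ a₁.antipode ▷ A ⊗≫ a₁.mul := by monoidal
    _ = 𝟙 _ ⊗≫ Δ[A] ⊗≫ A ◁ (A ◁ a₂.one ≫ a₂.mul) ⊗≫ a₁.antipode ▷ A ⊗≫ a₁.mul := by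
      rw [whisker_exchange]; monoidal
    _ = 𝟙 _ ⊗≫ (Δ[A] ≫ a₁.antipode ▷ A ≫ a₁.mul) := by rw [ha₂.mul_one]; monoidal
    _ = _ := by rw [← comul, ha₁.antipode_left, counit]; monoidal

section

attribute [local instance] ComonObj.instTensorUnit

/-- The two units of a Hopf brace coincide. -/
lemma IsHopfBrace.one_eq {x₁ x₂ : HopfData X} (hx : IsHopfBrace x₁ x₂) : x₁.one = x₂.one := by
  let _ := hx.isHopf₁.comonObj
  have _ : IsComonHom x₂.one :=
    ⟨by change _ ≫ x₁.counit = _; rw [hx.counit_eq]; exact hx.isHopf₂.one_counit,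
      by change _ ≫ x₁.comul = _; rw [hx.comul_eq]; exact hx.isHopf₂.one_comul⟩
  have compat : X ◁ x₁.mul ≫ x₂.mul = pair x₂.mul (lact x₁.mul x₁.antipode x₂.mul) ≫ x₁.mul := by
    rw [hx.compat, pair_eq, Category.assoc, Category.assoc]; rfl
  have hhat : hat (λ_ X).hom = (λ_ X).hom ≫ (ρ_ X).inv := by
    rw [hat, ComonObj.instTensorUnit_comul, braiding_tensorUnit_left]; monoidal
  -- At `x = 1₂` the brace axiom reads `b c = b (s c)` with `s = λ¹(1₂)`. Taking `b = 1₁`, then `c =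
  -- 1₁`, gives `s = 1₁`.
  have h := x₂.one ▷ (X ⊗ X) ≫= compat
  rw [← whisker_exchange_assoc, hx.isHopf₂.one_mul, ← Category.assoc, whiskerRight_pair,
    whiskerRight_lact, hx.isHopf₂.one_mul, pair, hhat, lact, ComonObj.instTensorUnit_comul,
    MonoidalCategory.tensorHom_def'] at h
  set s := x₂.one ≫ x₁.antipode with hs
  have h₂ : s ▷ X ≫ x₁.mul = (λ_ X).hom := by
    symm
    calc
      _ = 𝟙 _ ⊗≫ (x₁.one ▷ X ≫ x₁.mul) ⊗≫ 𝟙 _ := by rw [hx.isHopf₁.one_mul]; monoidal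
      _ = ((λ_ _).inv ≫ 𝟙_ C ◁ (x₁.one ▷ X)) ≫ (𝟙_ C ◁ x₁.mul ≫ (λ_ X).hom) := by monoidal
      _ = 𝟙 _ ⊗≫ (x₁.one ▷ (𝟙_ C ⊗ X) ≫ X ◁ (s ▷ X ≫ x₁.mul)) ≫ x₁.mul := by rw [h]; monoidal
      _ = 𝟙 _ ⊗≫ (s ▷ X ≫ x₁.mul) ⊗≫ (x₁.one ▷ X ≫ x₁.mul) := by
        rw [← whisker_exchange]; monoidal
      _ = _ := by rw [hx.isHopf₁.one_mul]; monoidal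
  have h₃ : s = x₁.one := by
    calc
      _ = 𝟙 _ ⊗≫ s ⊗≫ (X ◁ x₁.one ≫ x₁.mul) := by rw [hx.isHopf₁.mul_one]; monoidal
      _ = 𝟙 _ ⊗≫ (s ▷ 𝟙_ C ≫ X ◁ x₁.one) ⊗≫ x₁.mul := by monoidal
      _ = 𝟙 _ ⊗≫ 𝟙_ C ◁ x₁.one ⊗≫ (s ▷ X ≫ x₁.mul) := by rw [← whisker_exchange]; monoidal
      _ = _ := by rw [h₂]; monoidal
  -- As `1₂` is group-like, `1₂ ·₁ s = 1₁`; with `s = 1₁` this is the claim.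
  have h₄ := inv_right_of_isComonHom hx.isHopf₁ rfl rfl x₂.one
  rw [← hs, h₃, conv, ComonObj.instTensorUnit_counit, ComonObj.instTensorUnit_comul,
    Category.id_comp, MonoidalCategory.tensorHom_def] at h₄
  refine h₄.symm.trans ?_
  calc
    _ = 𝟙 _ ⊗≫ x₂.one ⊗≫ (X ◁ x₁.one ≫ x₁.mul) := by monoidal
    _ = _ := by rw [hx.isHopf₁.mul_one]; monoidal

end

/-- Left multiplication by `A` touches only the factor `A` in both products. Cancelling `inl` then
identifies `Γ` of the twisted products, restricted to `A`, with `Γ_A ⊗ H`. -/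
lemma lact_inl_Gamma [ComonObj A] (ha₁ : a₁.IsHopf) (hh₁ : h₁.IsHopf)
    (hΨ₁ : IsDistributive a₁ h₁ Ψ₁) (hΨ₂ : IsDistributive a₂ h₂ Ψ₂) (comulA : a₁.comul = Δ[A])
    (counitA : a₁.counit = ε[A]) (oneH : h₁.one = h₂.one)
    (hh₂ : h₂.IsHopf) :
    lact (twistedProduct a₁ h₁ Ψ₁).mul (inl A h₁) ((α_ A A H).inv ≫ Gamma a₁ a₂ ▷ H) =
      inl A h₁ ▷ (A ⊗ H) ≫ (twistedProduct a₂ h₂ Ψ₂).mul := by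
  have inl_eq : inl A h₁ = inl A h₂ := by rw [inl, inl, oneH]
  have h := lact_inl hΨ₁ hh₁ (𝟙 A) (Gamma a₁ a₂)
  have hconv := inv_right_of_isComonHom ha₁ comulA counitA (𝟙 A)
  rw [Category.id_comp, conv] at hconv
  have hG : Gamma a₁ a₂ = lact a₁.mul a₁.antipode a₂.mul := by rw [Gamma, comulA, lact]
  rw [Category.id_comp, hG, lact_lact ha₁.mul_assoc, hconv, lact_counit ha₁.one_mul] at h
  rw [hG, h, inl_eq, hΨ₂.inl_mul hh₂.one_mul]

lemma measuresAlong_inl_inl [ComonObj A] (hh₁ : h₁.IsHopf) (hΨ₁ : IsDistributive a₁ h₁ Ψ₁)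
    (hA : MeasuresAlong a₁.mul (Gamma a₁ a₂) (𝟙 A)) :
    MeasuresAlong (twistedProduct a₁ h₁ Ψ₁).mul ((α_ A A H).inv ≫ Gamma a₁ a₂ ▷ H)
      (inl A h₁) := by
  rw [MeasuresAlong, id_whiskerRight, Category.id_comp, whiskerLeft_id, Category.id_comp] at hA
  have h : A ◁ inl A h₁ ≫ (α_ A A H).inv ≫ Gamma a₁ a₂ ▷ H = Gamma a₁ a₂ ≫ inl A h₁ := by
    rw [inl]
    calc
      _ = 𝟙 _ ⊗≫ ((A ⊗ A) ◁ h₁.one ≫ Gamma a₁ a₂ ▷ H) := by monoidal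
      _ = _ := by rw [whisker_exchange]; monoidal
  rw [MeasuresAlong, h, pair_inl_mul hΨ₁ hh₁, hΨ₁.inl_mul hh₁.one_mul, pair_associator_inv]
  calc
    _ = 𝟙 _ ⊗≫ (A ◁ a₁.mul ≫ Gamma a₁ a₂) ▷ H := by monoidal
    _ = _ := by rw [hA]; monoidal

/-- `Γ_A(a, 1) = ε(a) 1` makes the first factor on the right just `h`, leaving (C2) multiplied by a
free variable of `H`, which is then removed. -/
lemma measuresAlong_inl_inr_iff [ComonObj A] (ha₁ : a₁.IsHopf) (ha₂ : a₂.IsHopf)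
    (hh₁ : h₁.IsHopf) (comulA : a₁.comul = Δ[A]) (counitA : a₁.counit = ε[A])
    (oneA : a₁.one = a₂.one) :
    MeasuresAlong (twistedProduct a₁ h₁ Ψ₁).mul ((α_ A A H).inv ≫ Gamma a₁ a₂ ▷ H) (inr H a₁) ↔
      CondC2 a₁ a₂ Ψ₁ := by
  have h : A ◁ inr H a₁ ≫ (α_ A A H).inv ≫ Gamma a₁ a₂ ▷ H = sndHom A H ≫ inr H a₁ := by
    rw [inr]
    calc
      _ = 𝟙 _ ⊗≫ (A ◁ a₂.one ≫ Gamma a₁ a₂) ▷ H := by rw [oneA]; monoidal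
      _ = _ := by rw [Gamma_one ha₁ ha₂ comulA counitA, sndHom]; monoidal
  rw [MeasuresAlong, h, pair_inr_mul ha₁, inr_mul ha₁.one_mul, pair, hat_sndHom, CondC2]
  refine Iff.trans (Eq.congr ?_ ?_) ((cancel_epi (A ◁ (α_ H A H).inv ≫
    (α_ A (H ⊗ A) H).inv)).trans (whiskerRight_mul_inj_iff hh₁))
  · calc
      _ = 𝟙 _ ⊗≫ A ◁ Ψ₁ ▷ H ⊗≫ ((A ⊗ A) ◁ h₁.mul ≫ Gamma a₁ a₂ ▷ H) := by monoidal
      _ = _ := by rw [whisker_exchange]; monoidal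
  · monoidal

/-- `h ·₂ a` equals `φ(h₁, a) ·₁ h₂`, so the right side is `φ(h₁, a) ·₁ (h₂ ·₁ K(h₃, b))`. By `hK`
the bracket is `h₂ ·₂ b`, and no antipode is left. -/
lemma inr_inl_iff [ComonObj H] (ha₁ : a₁.IsHopf) (ha₂ : a₂.IsHopf) (hh₁ : h₁.IsHopf)
    (hh₂ : h₂.IsHopf) (hΨ₁ : IsDistributive a₁ h₁ Ψ₁) (oneA : a₁.one = a₂.one)
    (oneH : h₁.one = h₂.one)
    {φ : H ⊗ A ⟶ A} {K : H ⊗ (A ⊗ H) ⟶ A ⊗ H} (hφ : Ψ₂ = hat φ)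
    (hK : lact (twistedProduct a₁ h₁ Ψ₁).mul (inr H a₁) K =
      inr H a₁ ▷ (A ⊗ H) ≫ (twistedProduct a₂ h₂ Ψ₂).mul) :
    H ◁ (inl A h₁ ▷ (A ⊗ H) ≫ (twistedProduct a₁ h₁ Ψ₁).mul) ≫
        inr H a₁ ▷ (A ⊗ H) ≫ (twistedProduct a₂ h₂ Ψ₂).mul =
      pair (H ◁ inl A h₁ ≫ inr H a₁ ▷ (A ⊗ H) ≫ (twistedProduct a₂ h₂ Ψ₂).mul) K ≫
        (twistedProduct a₁ h₁ Ψ₁).mul ↔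
      CondC3 a₁ Ψ₂ := by
  have inl_eq : inl A h₁ = inl A h₂ := by rw [inl, inl, oneH]
  have inr_eq : inr H a₁ = inr H a₂ := by rw [inr, inr, oneA]
  have h : H ◁ inl A h₁ ≫ inr H a₁ ▷ (A ⊗ H) ≫ (twistedProduct a₂ h₂ Ψ₂).mul =
      ract (twistedProduct a₁ h₁ Ψ₁).mul (φ ≫ inl A h₁) (inr H a₁) := by
    rw [ract, hat_comp, Category.assoc, ← MonoidalCategory.tensorHom_def_assoc,
      hΨ₁.inl_mul_inr hh₁.one_mul ha₁.mul_one, Category.comp_id, ← hφ, inl_eq, inr_eq,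
      ← MonoidalCategory.tensorHom_def'_assoc, inr_mul_inl ha₂.one_mul hh₂.mul_one]
  have assoc := hΨ₁.mul_assoc ha₁.mul_assoc hh₁.mul_assoc
  rw [h, pair_ract assoc, hK, pair_inl_mul hΨ₁ hh₁, hΨ₁.inl_mul hh₁.one_mul, inr_eq,
    inr_mul ha₂.one_mul, CondC3, pair, ← hφ]
  refine Iff.trans (Eq.congr ?_ ?_) ((cancel_epi (H ◁ (α_ A A H).inv ≫
    (α_ H (A ⊗ A) H).inv)).trans (whiskerRight_mul_inj_iff hh₂))
  · monoidal
  · calc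
      _ = 𝟙 _ ⊗≫ Ψ₂ ▷ (A ⊗ H) ⊗≫ A ◁ Ψ₂ ▷ H ⊗≫ ((A ⊗ A) ◁ h₂.mul ≫ a₁.mul ▷ H) := by monoidal
      _ = _ := by rw [whisker_exchange]; monoidal

/-- The right side is `(x₁ ·₂ y) ·₁ λ¹(x₂) ·₁ (x₃ ·₂ b)`; grouping the antipode with the left factor
produces `Γ'(x₁, y) ·₁ (x₂ ·₂ b)`. -/
lemma inr_inr_iff [ComonObj H] (ha₁ : a₁.IsHopf) (ha₂ : a₂.IsHopf) (hh₁ : h₁.IsHopf)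
    (hΨ₁ : IsDistributive a₁ h₁ Ψ₁) (hΨ₂ : IsDistributive a₂ h₂ Ψ₂) (comulH : h₁.comul = Δ[H])
    (oneA : a₁.one = a₂.one)
    {K : H ⊗ (A ⊗ H) ⟶ A ⊗ H}
    (hK : K = lact (twistedProduct a₁ h₁ Ψ₁).mul (h₁.antipode ≫ inr H a₁)
      (inr H a₁ ▷ (A ⊗ H) ≫ (twistedProduct a₂ h₂ Ψ₂).mul)) :
    H ◁ (inr H a₁ ▷ (A ⊗ H) ≫ (twistedProduct a₁ h₁ Ψ₁).mul) ≫
        inr H a₁ ▷ (A ⊗ H) ≫ (twistedProduct a₂ h₂ Ψ₂).mul =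
      pair (H ◁ inr H a₁ ≫ inr H a₁ ▷ (A ⊗ H) ≫ (twistedProduct a₂ h₂ Ψ₂).mul) K ≫
        (twistedProduct a₁ h₁ Ψ₁).mul ↔
      CondC1 h₁ h₂ Ψ₁ Ψ₂ := by
  have inr_eq : inr H a₁ = inr H a₂ := by rw [inr, inr, oneA]
  have h : H ◁ inr H a₁ ≫ inr H a₁ ▷ (A ⊗ H) ≫ (twistedProduct a₂ h₂ Ψ₂).mul =
      h₂.mul ≫ inr H a₁ := by
    rw [inr_eq, ← MonoidalCategory.tensorHom_def'_assoc, hΨ₂.inr_mul_inr ha₂.mul_one]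
  have assoc := hΨ₁.mul_assoc ha₁.mul_assoc hh₁.mul_assoc
  have hract : ract (twistedProduct a₁ h₁ Ψ₁).mul (h₂.mul ≫ inr H a₁) (h₁.antipode ≫ inr H a₁) =
      Gamma' h₁ h₂ ≫ inr H a₁ := by
    have e : (inr H a₁ ⊗ₘ h₁.antipode ≫ inr H a₁) = H ◁ h₁.antipode ≫ (inr H a₁ ⊗ₘ inr H a₁) := by
      rw [← id_tensorHom, tensorHom_comp_tensorHom, Category.id_comp]
    rw [ract, hat_comp, Category.assoc, ← MonoidalCategory.tensorHom_def_assoc, e, Category.assoc,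
      hΨ₁.inr_mul_inr ha₁.mul_one, hat, Gamma', comulH]
    simp [MonoidalCategory.tensorHom_def]
  have hhat : h₁.comul ▷ H ≫ (α_ H H H).hom ≫ H ◁ (β_ H H).hom ≫ (α_ H H H).inv ≫
      Gamma' h₁ h₂ ▷ H = hat (Gamma' h₁ h₂) := by rw [hat, comulH]
  rw [h, hK, ← pair_ract assoc, hract, pair_inr_mul ha₁, inr_mul ha₁.one_mul, inr_eq,
    inr_mul ha₂.one_mul, CondC1, hhat, pair]
  refine Iff.trans (Eq.congr ?_ ?_) (Iff.trans (cancel_epi (α_ H H (A ⊗ H)).inv) eq_comm)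
  · simp only [mid, Iso.trans_hom, Iso.trans_inv,
      whiskerLeftIso_hom, whiskerLeftIso_inv, Iso.symm_hom, Iso.symm_inv]
    calc
      _ = 𝟙 _ ⊗≫ H ◁ Ψ₁ ▷ H ⊗≫ ((H ⊗ A) ◁ h₁.mul ≫ Ψ₂ ▷ H) ⊗≫ A ◁ h₂.mul := by monoidal
      _ = _ := by rw [whisker_exchange, MonoidalCategory.tensorHom_def]; monoidal
  · simp only [mid, Iso.trans_hom, Iso.trans_inv,
      whiskerLeftIso_hom, whiskerLeftIso_inv, Iso.symm_hom, Iso.symm_inv]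
    calc
      _ = 𝟙 _ ⊗≫ hat (Gamma' h₁ h₂) ▷ A ▷ H ⊗≫ H ◁ Ψ₂ ▷ H ⊗≫
            ((H ⊗ A) ◁ h₂.mul ≫ Ψ₁ ▷ H) ⊗≫ A ◁ h₁.mul := by monoidal
      _ = _ := by rw [whisker_exchange, MonoidalCategory.tensorHom_def]; monoidal

end Conditions

/-! ### Assembly of the equivalence. -/

section Main

variable {C : Type u} [Category.{v} C] [MonoidalCategory C] [SymmetricCategory C]
variable {A H : C} {a₁ a₂ : HopfData A} {h₁ h₂ : HopfData H}

theorem bicrossed_smash_compat_iff (hA : IsHopfBrace a₁ a₂) (hH : IsHopfBrace h₁ h₂)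
    {φ₁ φ₂ : H ⊗ A ⟶ A} {ϕ : H ⊗ A ⟶ H} (P : IsMatchedPair a₁ h₁ φ₁ ϕ)
    (alg : IsLeftModuleAlgebra h₂ a₂ φ₂) (coalg : IsLeftModuleCoalgebra h₂ a₂ φ₂)
    (cocomm : InCocommutativityClass h₂ φ₂) :
    (A ⊗ H) ◁ (bicrossed a₁ h₁ φ₁ ϕ).mul ≫ (smash a₂ h₂ φ₂).mul =
      (bicrossed a₁ h₁ φ₁ ϕ).comul ▷ ((A ⊗ H) ⊗ (A ⊗ H)) ≫
        tensorμ (A ⊗ H) (A ⊗ H) (A ⊗ H) (A ⊗ H) ≫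
        ((smash a₂ h₂ φ₂).mul ⊗ₘ Gamma (bicrossed a₁ h₁ φ₁ ϕ) (smash a₂ h₂ φ₂)) ≫
        (bicrossed a₁ h₁ φ₁ ϕ).mul ↔
    CondC1 h₁ h₂ (Psi a₁ h₁ φ₁ ϕ) (smashPsi h₂ φ₂) ∧ CondC2 a₁ a₂ (Psi a₁ h₁ φ₁ ϕ) ∧
      CondC3 a₁ (smashPsi h₂ φ₂) := by
  have ha₁ := hA.isHopf₁
  have ha₂ := hA.isHopf₂
  have hh₁ := hH.isHopf₁
  have hh₂ := hH.isHopf₂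
  have hB₁ : (twistedProduct a₁ h₁ (Psi a₁ h₁ φ₁ ϕ)).IsHopf := P.isHopf
  have hB₂ : (twistedProduct a₂ h₂ (smashPsi h₂ φ₂)).IsHopf :=
    smash_isHopf ha₂ hh₂ alg coalg cocomm
  have hΨ₁ := P.isDistributive
  have hΨ₂ := smashPsi_isDistributive ha₂ hh₂ alg coalg cocomm
  have oneA := hA.one_eq
  have oneH := hH.one_eq
  let _ := ha₁.comonObj
  let _ := hh₁.comonObj
  have hhat : smashPsi h₂ φ₂ = hat φ₂ := by rw [smashPsi, ← hH.comul_eq]; rfl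
  have inl_eq : inl A h₁ = inl A h₂ := by rw [inl, inl, oneH]
  have inr_eq : inr H a₁ = inr H a₂ := by rw [inr, inr, oneA]
  rw [bicrossed, smash]
  -- From here on the proof needs only that `Ψ₁`, `Ψ₂` are distributive laws with Hopf twisted
  -- products, and that `Ψ₂ = hat φ₂`.
  generalize Psi a₁ h₁ φ₁ ϕ = Ψ₁ at *
  generalize smashPsi h₂ φ₂ = Ψ₂ at *
  have comul : (twistedProduct a₁ h₁ Ψ₁).comul = Δ[A ⊗ H] := (Comon.tensorObj_comul A H).symm
  have counit : (twistedProduct a₁ h₁ Ψ₁).counit = ε[A ⊗ H] := rfl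
  have comul₂ : (twistedProduct a₂ h₂ Ψ₂).comul = Δ[A ⊗ H] := by
    rw [← comul, twistedProduct, twistedProduct, hA.comul_eq, hH.comul_eq]
  have counit₂ : (twistedProduct a₂ h₂ Ψ₂).counit = ε[A ⊗ H] := by
    rw [← counit, twistedProduct, twistedProduct, hA.counit_eq, hH.counit_eq]
  have _ : IsComonHom (twistedProduct a₂ h₂ Ψ₂).mul := by
    constructor
    · rw [← counit₂, hB₂.mul_counit, Comon.tensorObj_counit]
      simp only [counit₂]
    · rw [← comul₂, hB₂.mul_comul, Comon.tensorObj_comul (A ⊗ H), comul₂, Category.assoc]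
  have _ : IsComonHom (inl A h₁) := by
    let _ := ComonObj.instTensorUnit C
    have _ : IsComonHom h₁.one := ⟨hh₁.one_counit, hh₁.one_comul⟩
    exact isComonHom_inl
  have _ : IsComonHom (inr H a₁) := by
    let _ := ComonObj.instTensorUnit C
    have _ : IsComonHom a₁.one := ⟨ha₁.one_counit, ha₁.one_comul⟩
    exact isComonHom_inr
  have gen₁ := hΨ₁.inl_mul_inr hh₁.one_mul ha₁.mul_one
  have gen₂ := hΨ₂.inl_mul_inr hh₂.one_mul ha₂.mul_one
  rw [← inl_eq, ← inr_eq] at gen₂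
  have inl_left := inv_left_of_isComonHom hB₁ comul counit (inl A h₁)
  have inr_right := inv_right_of_isComonHom hB₁ comul counit (inr H a₁)
  have inr_left := inv_left_of_isComonHom hB₁ comul counit (inr H a₁)
  have hinl : inl A h₁ ▷ (A ⊗ H) ≫ lact (twistedProduct a₁ h₁ Ψ₁).mul
      (twistedProduct a₁ h₁ Ψ₁).antipode (twistedProduct a₂ h₂ Ψ₂).mul =
      (α_ A A H).inv ≫ Gamma a₁ a₂ ▷ H := by
    rw [whiskerRight_lact]
    exact lact_eq_of_lact_eq hB₁.mul_assoc hB₁.one_mul inl_left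
      (lact_inl_Gamma ha₁ hh₁ hΨ₁ hΨ₂ rfl rfl oneH hh₂)
  have hinr : conv (twistedProduct a₁ h₁ Ψ₁).mul (inr H a₁) (h₁.antipode ≫ inr H a₁) =
      ε[H] ≫ (twistedProduct a₁ h₁ Ψ₁).one := by
    have h : conv h₁.mul (𝟙 H) h₁.antipode = ε[H] ≫ h₁.one := by
      rw [conv, id_tensorHom]; exact hh₁.antipode_right
    rw [← one_inr, ← reassoc_of% h, conv_comp (hΨ₁.inr_mul_inr ha₁.mul_one), Category.id_comp]
  set L := inr H a₁ ▷ (A ⊗ H) ≫ (twistedProduct a₂ h₂ Ψ₂).mul with hL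
  -- The antipode of `H` followed by `inr`, and `inr` followed by the antipode of the product, are
  -- both convolution inverse to `inr`, so they act alike. The first form is the one that yields
  -- `Γ'`.
  have hlact : lact (twistedProduct a₁ h₁ Ψ₁).mul
      (inr H a₁ ≫ (twistedProduct a₁ h₁ Ψ₁).antipode) L =
      lact (twistedProduct a₁ h₁ Ψ₁).mul (h₁.antipode ≫ inr H a₁) L := by
    refine lact_eq_of_lact_eq hB₁.mul_assoc hB₁.one_mul inr_left ?_
    rw [conv] at hinr
    rw [lact_lact hB₁.mul_assoc, hinr, lact_counit hB₁.one_mul]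
  have hlact' : lact (twistedProduct a₁ h₁ Ψ₁).mul (inr H a₁)
      (lact (twistedProduct a₁ h₁ Ψ₁).mul (inr H a₁ ≫ (twistedProduct a₁ h₁ Ψ₁).antipode) L) =
      L := by
    rw [conv] at inr_right
    rw [lact_lact hB₁.mul_assoc, inr_right, lact_counit hB₁.one_mul]
  have hmeas : MeasuresAlong a₁.mul (Gamma a₁ a₂) (𝟙 A) :=
    (compat_iff_measuresAlong ha₁ rfl rfl).1 hA.compat
  rw [compat_iff_measuresAlong hB₁ comul counit,
    measuresAlong_iff_of_generators hB₁ hB₂ comul counit gen₁ gen₂, hinl,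
    whiskerRight_lact, measuresAlong_inl_inr_iff ha₁ ha₂ hh₁ rfl rfl oneA]
  rw [conv] at inr_right
  rw [measuresAlong_lact_iff hB₁.mul_assoc hB₁.one_mul inr_right,
    measuresAlong_lact_iff hB₁.mul_assoc hB₁.one_mul inr_right,
    inr_inl_iff ha₁ ha₂ hh₁ hh₂ hΨ₁ oneA oneH hhat hlact',
    inr_inr_iff ha₁ ha₂ hh₁ hΨ₁ hΨ₂ rfl oneA hlact]
  have := measuresAlong_inl_inl hh₁ hΨ₁ hmeas
  tauto

end Main

end HopfBraces

theorem theorem2p13 {C : Type*} [Category C] [MonoidalCategory C] [SymmetricCategory C]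
    {A H : C} (A₁ A₂ : HopfBraces.HopfData A) (H₁ H₂ : HopfBraces.HopfData H)
    (hA : HopfBraces.IsHopfBrace A₁ A₂) (hH : HopfBraces.IsHopfBrace H₁ H₂)
    (φ₁ φ₂ : H ⊗ A ⟶ A) (ϕ : H ⊗ A ⟶ H)
    (hmp : HopfBraces.IsMatchedPair A₁ H₁ φ₁ ϕ)
    (halg : HopfBraces.IsLeftModuleAlgebra H₂ A₂ φ₂)
    (hcoalg : HopfBraces.IsLeftModuleCoalgebra H₂ A₂ φ₂)
    (hcc : HopfBraces.InCocommutativityClass H₂ φ₂) :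
    HopfBraces.IsHopfBrace (HopfBraces.bicrossed A₁ H₁ φ₁ ϕ) (HopfBraces.smash A₂ H₂ φ₂) ↔
      HopfBraces.CondC1 H₁ H₂ (HopfBraces.Psi A₁ H₁ φ₁ ϕ) (HopfBraces.smashPsi H₂ φ₂) ∧
      HopfBraces.CondC2 A₁ A₂ (HopfBraces.Psi A₁ H₁ φ₁ ϕ) ∧
      HopfBraces.CondC3 A₁ (HopfBraces.smashPsi H₂ φ₂) := by
  -- Both structures are Hopf algebras with the same coalgebra in any case, so only the
  -- compatibility axiom carries content.
  rw [← HopfBraces.bicrossed_smash_compat_iff hA hH hmp halg hcoalg hcc]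
  refine ⟨fun h => h.compat, fun h => ⟨hmp.isHopf,
    HopfBraces.smash_isHopf hA.isHopf₂ hH.isHopf₂ halg hcoalg hcc, ?_, ?_, h⟩⟩
  · simp only [HopfBraces.bicrossed, HopfBraces.smash, HopfBraces.twistedProduct,
      hA.counit_eq, hH.counit_eq]
  · simp only [HopfBraces.bicrossed, HopfBraces.smash, HopfBraces.twistedProduct,
      hA.comul_eq, hH.comul_eq]
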